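/- Let $(X_i,Y_i)$, $i\ge 1$, be i.i.d. observations, where $X_i\in\mathbb R^f$ is a feature vector and $Y_i\in\{0,1\}^c$ is a vector of class indicators; write $(X,Y)$ for a generic pair. Fix a class $j$, let $q_j=E\,Y^{(j)}$, and suppose that $P(Y^{(j)}=1\mid X)=g(X,\theta_j)$ almost surely for a parametric family $g(t,\theta)$, $\theta\in\mathbb R^p$. Let $g'$ be the vector of partial derivatives of $g$ in $\theta$, let $w=1/(g(1-g))$, and put $$\psi(t,y,\theta)=w(t,\theta)\{y-g(t,\theta)\}g'(t,\theta),\quad A_j=E[w(X,\theta_j)g'(X,\theta_j)g'(X,\theta_j)^T],\quad B_j=E[g'(X,\theta_j)].$$ Regularity conditions. There are an open set $U\subseteq\mathbb R^p$ and a compact set $K\subseteq U$ with $\theta_j$ in the interior of $K$ such that: $g$ is jointly measurable; for almost every $t$ (with respect to the law of $X$), $g(t,\cdot)$ is twice continuously differentiable on $U$ with values in $(0,1)$ there; there is a function $H$ with $E|H(X)|<\infty$ such that for almost every $t$, all $\theta\in K$ and $y\in\{0,1\}$, the norms of $g'(t,\theta)$, $\psi(t,y,\theta)$ and the derivative $\partial\psi(t,y,\theta)/\partial\theta$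 are at most $H(t)$; $E[w(X,\theta_j)\|g'(X,\theta_j)\|^2]<\infty$ and $A_j$ is invertible; and $\theta_j$ is the only $\theta\in K$ with $E\,\psi(X,Y^{(j)},\theta)=0$. For each $m$ let $\hat\theta_{j,m}$ be a random vector such that, with probability tending to $1$ as $m\to\infty$, $\hat\theta_{j,m}\in K$ and $\sum_{i=1}^m\psi(X_i,Y_i^{(j)},\hat\theta_{j,m})=0$. Of the first $n$ observations the first $r=r_n\le n$ are labeled, and $r_n/n\to\gamma>0$ as $n\to\infty$. Put $$\hat q_{j}=\hat q_j(r,n)=\frac1n\sum_{i=1}^n g(X_i,\hat\theta_{j,r}),\qquad \bar Y^{(j)}=\frac1r\sum_{i=1}^r Y_i^{(j)}.$$ Say that an estimator $T_n$ of $q_j$ has asymptotic variance $v_n$ if $\sqrt n(T_n-q_j)$ converges in distribution to $N(0,s)$ with $s=\lim_n n v_n\in[0,\infty)$ (where $N(0,0)$ is the point mass at $0$). Then: 1. $\hat q_j(r,n)$ has asymptotic variance $\mathrm{AVar}(r,n)=\frac1n\mathrm{Var}[g(X,\theta_j)]+\frac1r B_j^TA_j^{-1}B_j$; the estimator $\hat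 q_j(r,r)$, which uses no unlabeled data, has asymptotic variance $\mathrm{AVar}(r,r)$; and $\bar Y^{(j)}$ has asymptotic variance $\frac1r\mathrm{Var}[Y^{(j)}]$. 2. For all integers $1\le r\le n$: $\mathrm{AVar}(r,r)-\mathrm{AVar}(r,n)=\left(\frac1r-\frac1n\right)\mathrm{Var}[g(X,\theta_j)]$, $\mathrm{AVar}(r,r)\le\frac1r\mathrm{Var}[Y^{(j)}]$, and hence $\mathrm{AVar}(r,n)\le\frac1r\mathrm{Var}[Y^{(j)}]$. The last inequality is strict if $r<n$ and $g(X,\theta_j)$ is not almost surely constant. 3. If $N(0,s_1)$ and $N(0,s_2)$ are the limit laws of $\sqrt n(\hat q_j(r_n,n)-q_j)$ and $\sqrt n(\bar Y^{(j)}-q_j)$, then $s_1\le s_2$, with strict inequality if $\gamma<1$ and $g(X,\theta_j)$ is not almost surely constant. -/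

import Mathlib

open MeasureTheory ProbabilityTheory Filter Topology

namespace Unlabeled

noncomputable section

/-- The weight `w(t, θ) = 1 / (g(t, θ) (1 - g(t, θ)))`, the reciprocal of the conditional variance
of the class indicator given the features. -/
def weight {f p : ℕ} (g : (Fin f → ℝ) → EuclideanSpace ℝ (Fin p) → ℝ)
    (t : Fin f → ℝ) (ϑ : EuclideanSpace ℝ (Fin p)) : ℝ :=
  1 / (g t ϑ * (1 - g t ϑ))

/-- One summand `w(t, θ) (y - g(t, θ)) g'(t, θ)` of the estimating equation, where `g'` is the
vector of partial derivatives of `g` with respect to the parameter. -/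
def score {f p : ℕ} (g : (Fin f → ℝ) → EuclideanSpace ℝ (Fin p) → ℝ)
    (t : Fin f → ℝ) (y : ℝ) (ϑ : EuclideanSpace ℝ (Fin p)) : EuclideanSpace ℝ (Fin p) :=
  (weight g t ϑ * (y - g t ϑ)) • gradient (g t) ϑ

/-- The estimator `(1/n) ∑_{i ≤ n} g(X_i, θ̂_m)` of a class probability, with the parameter estimated
from the first `m` (labeled) observations and the average taken over all `n` observations.
Observations are numbered from `0`. -/
def qHat {Ω : Type*} {f p : ℕ} (X : ℕ → Ω → Fin f → ℝ)
    (g : (Fin f → ℝ) → EuclideanSpace ℝ (Fin p) → ℝ)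
    (θhat : ℕ → Ω → EuclideanSpace ℝ (Fin p)) (m n : ℕ) (ω : Ω) : ℝ :=
  (1 / (n : ℝ)) * ∑ i ∈ Finset.range n, g (X i ω) (θhat m ω)

/-- The proportion of class `j` among the first `m` (labeled) observations. -/
def yBar {Ω : Type*} {c : ℕ} (Y : ℕ → Ω → Fin c → ℝ) (j : Fin c) (m : ℕ) (ω : Ω) : ℝ :=
  (1 / (m : ℝ)) * ∑ i ∈ Finset.range m, Y i ω j

/-- The observations `(X_i, Y_i)` are independent and identically distributed, where `X_i` is a
vector of features and `Y_i` a vector of `0`-`1` class indicators. -/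
structure IsSample {Ω : Type*} [MeasurableSpace Ω] (μ : Measure Ω) {f c : ℕ}
    (X : ℕ → Ω → Fin f → ℝ) (Y : ℕ → Ω → Fin c → ℝ) : Prop where
  measurable_X : ∀ i, Measurable (X i)
  measurable_Y : ∀ i, Measurable (Y i)
  zero_or_one : ∀ i ω k, Y i ω k = 0 ∨ Y i ω k = 1
  indep : iIndepFun (fun i ω => (X i ω, Y i ω)) μ
  identDistrib : ∀ i, IdentDistrib (fun ω => (X i ω, Y i ω)) (fun ω => (X 0 ω, Y 0 ω)) μ μ

/-- The matrix `A = E[w(X, θ) g'(X, θ) g'(X, θ)ᵀ]`. -/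
def matA {Ω : Type*} [MeasurableSpace Ω] (μ : Measure Ω) {f p : ℕ} (X : ℕ → Ω → Fin f → ℝ)
    (g : (Fin f → ℝ) → EuclideanSpace ℝ (Fin p) → ℝ) (θ : EuclideanSpace ℝ (Fin p)) :
    Matrix (Fin p) (Fin p) ℝ :=
  Matrix.of fun k l =>
    ∫ ω, weight g (X 0 ω) θ * gradient (g (X 0 ω)) θ k * gradient (g (X 0 ω)) θ l ∂μ

/-- The vector `B = E[g'(X, θ)]`. -/
def vecB {Ω : Type*} [MeasurableSpace Ω] (μ : Measure Ω) {f p : ℕ} (X : ℕ → Ω → Fin f → ℝ)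
    (g : (Fin f → ℝ) → EuclideanSpace ℝ (Fin p) → ℝ) (θ : EuclideanSpace ℝ (Fin p)) :
    Fin p → ℝ :=
  fun k => ∫ ω, gradient (g (X 0 ω)) θ k ∂μ

/-- Smoothness, moment and identifiability conditions on the family `g` at the true parameter `θ`.
The family is smooth on an open set `U` of parameters, and the estimator is sought in a compact
set `K ⊆ U` that has `θ` in its interior. -/
structure IsRegular {Ω : Type*} [MeasurableSpace Ω] (μ : Measure Ω) {f c p : ℕ}
    (X : ℕ → Ω → Fin f → ℝ) (Y : ℕ → Ω → Fin c → ℝ) (j : Fin c)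
    (g : (Fin f → ℝ) → EuclideanSpace ℝ (Fin p) → ℝ) (θ : EuclideanSpace ℝ (Fin p))
    (U K : Set (EuclideanSpace ℝ (Fin p))) : Prop where
  isOpen : IsOpen U
  isCompact : IsCompact K
  subset : K ⊆ U
  mem_interior : θ ∈ interior K
  measurable : Measurable (Function.uncurry g)
  mem_Ioo : ∀ᵐ t ∂(μ.map (X 0)), ∀ ϑ ∈ U, g t ϑ ∈ Set.Ioo (0 : ℝ) 1
  contDiffOn : ∀ᵐ t ∂(μ.map (X 0)), ContDiffOn ℝ 2 (g t) U
  /-- An integrable bound, uniform in the parameter, for the first derivative of `g` and for the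
  score and its first derivative. -/
  envelope : ∃ H : (Fin f → ℝ) → ℝ, Integrable H (μ.map (X 0)) ∧
    ∀ᵐ t ∂(μ.map (X 0)), ∀ ϑ ∈ K, ‖gradient (g t) ϑ‖ ≤ H t ∧
      ∀ y : ℝ, y = 0 ∨ y = 1 →
        ‖score g t y ϑ‖ ≤ H t ∧ ‖fderiv ℝ (fun ϑ' => score g t y ϑ') ϑ‖ ≤ H t
  /-- The mean that defines `A` exists. -/
  integrable_A :
    Integrable (fun ω => weight g (X 0 ω) θ * ‖gradient (g (X 0 ω)) θ‖ ^ 2) μ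
  isUnit_A : IsUnit (matA μ X g θ)
  /-- In `K`, only the true parameter solves the population version of the estimating equation. -/
  identifiable : ∀ ϑ ∈ K, ∫ ω, score g (X 0 ω) (Y 0 ω j) ϑ ∂μ = 0 → ϑ = θ

/-- The probability that `θ̂_m` lies in `K` and is a root of the estimating equation
`0 = ∑_{i ≤ m} w(X_i, θ̂_m) (Y_i - g(X_i, θ̂_m)) g'(X_i, θ̂_m)` built from the first `m` observations
tends to one. -/
def IsRootEstimator {Ω : Type*} [MeasurableSpace Ω] (μ : Measure Ω) {f c p : ℕ}
    (X : ℕ → Ω → Fin f → ℝ) (Y : ℕ → Ω → Fin c → ℝ) (j : Fin c)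
    (g : (Fin f → ℝ) → EuclideanSpace ℝ (Fin p) → ℝ)
    (K : Set (EuclideanSpace ℝ (Fin p)))
    (θhat : ℕ → Ω → EuclideanSpace ℝ (Fin p)) : Prop :=
  (∀ m, AEMeasurable (θhat m) μ) ∧
  Tendsto (fun m => μ {ω | ¬ (θhat m ω ∈ K ∧
    ∑ i ∈ Finset.range m, score g (X i ω) (Y i ω j) (θhat m ω) = 0)}) atTop (𝓝 0)

/-- `√n (T_n - q)` converges in distribution to the normal law with mean `0` and variance `s`. -/
def HasLimitVariance {Ω : Type*} [MeasurableSpace Ω] (μ : Measure Ω) [IsProbabilityMeasure μ]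
    (T : ℕ → Ω → ℝ) (q s : ℝ) : Prop :=
  0 ≤ s ∧ TendstoInDistribution (fun (n : ℕ) ω => √(n : ℝ) * (T n ω - q)) atTop
    (id : ℝ → ℝ) (fun _ => μ) (gaussianReal 0 s.toNNReal)

/-- `v n` is the asymptotic variance of the estimator `T_n` of `q`: `T_n` is asymptotically normal
with mean `q` and variance `v n`, in the sense that `√n (T_n - q)` converges in distribution to a
centred normal law whose variance is the limit of `n * v n`. -/
def HasAsymptoticVariance {Ω : Type*} [MeasurableSpace Ω] (μ : Measure Ω)
    [IsProbabilityMeasure μ] (T : ℕ → Ω → ℝ) (q : ℝ) (v : ℕ → ℝ) : Prop :=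
  ∃ s : ℝ, Tendsto (fun n : ℕ => (n : ℝ) * v n) atTop (𝓝 s) ∧ HasLimitVariance μ T q s

/-- `(1/n) Var[g(X, θ)] + (1/m) Bᵀ A⁻¹ B`, for `m` labeled observations out of `n`. -/
def avarQHat {Ω : Type*} [MeasurableSpace Ω] (μ : Measure Ω) {f p : ℕ}
    (X : ℕ → Ω → Fin f → ℝ) (g : (Fin f → ℝ) → EuclideanSpace ℝ (Fin p) → ℝ)
    (θ : EuclideanSpace ℝ (Fin p)) (m n : ℕ) : ℝ :=
  (1 / (n : ℝ)) * variance (fun ω => g (X 0 ω) θ) μ +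
    (1 / (m : ℝ)) * (vecB μ X g θ ⬝ᵥ (matA μ X g θ)⁻¹.mulVec (vecB μ X g θ))

/-- `(1/m) Var[Y]`, the variance of the class `j` proportion among `m` observations. -/
def avarYBar {Ω : Type*} [MeasurableSpace Ω] (μ : Measure Ω) {c : ℕ}
    (Y : ℕ → Ω → Fin c → ℝ) (j : Fin c) (m : ℕ) : ℝ :=
  (1 / (m : ℝ)) * variance (fun ω => Y 0 ω j) μ

end

end Unlabeled

/-! Write `q` for the class probability, `V = Var[g(X, θ)]`, `b = A⁻¹B` and `κ = BᵀA⁻¹B`. The core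
is the linearization q̂(r, n) = (1/n) ∑_{i<n} g(X_i, θ) + (1/r) ∑_{i<r} ⟪ψ_i, b⟫ + o_P(n^{-1/2}),
with `ψ_i` the score at `θ`. It is proved path by path. By the uniform strong law
(`uniform_strong_law`) the averaged score, its derivative and the averaged derivative of `g`
converge uniformly on `K`, almost surely. Identifiability then drives every root in `K` to `θ`. The
limiting derivative of the score at `θ` is `-A`, which is invertible, so a mean value argument
(`eventually_plugin_linearization`) bounds the error by `ε` times the norm of the averaged score,
simultaneously for all roots in `K`. Since that norm is `O(n^{-1/2})` in mean square and `θhat` is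
such a root with probability tending to one, the remainder is negligible
(`tendstoInMeasure_mul_of_eventually_le`).

Labeled indices thus contribute `g - q + (n/r) ⟪ψ, b⟫` and unlabeled ones `g - q`; a central limit
theorem for two independent blocks applies (`hasLimitVariance_of_two_blocks`). Given the feature,
the score has mean zero, so it is uncorrelated with `g(X, θ)`, and `⟪ψ, b⟫` has variance `bᵀAb = κ`.
The limit variance is therefore `γ(V + κ/γ²) + (1 - γ)V = V + κ/γ`; with labeled data only it is `(V
+ κ)/γ`.

The comparison with the sample proportion rests on `Var Y = V + E[g(1-g)]` and on `κ ≤ E[g(1-g)]`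
(`IsGoodSet.quadratic_form_le`), which is a Cauchy–Schwarz inequality with weight `w = 1/(g(1-g))`.
Unlabeled data gain a further multiple of `V`, which is positive unless `g(X, θ)` is constant. -/

namespace Unlabeled

/-! ### Characteristic functions and the two-block central limit theorem -/

/-- Second-order expansion at the origin of the characteristic function of a centred square
integrable random variable. -/
lemma charFun_sub_isLittleO {Ω : Type*} [MeasurableSpace Ω] {P : Measure Ω}
    [IsProbabilityMeasure P] {X : Ω → ℝ} (hX : MemLp X 2 P) (h0 : ∫ ω, X ω ∂P = 0) :
    (fun t : ℝ => charFun (P.map X) t - (1 - (Var[X; P] : ℂ) * t ^ 2 / 2)) =o[𝓝 0]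
      fun t => t ^ 2 := by
  have hm : AEMeasurable X P := hX.aestronglyMeasurable.aemeasurable
  -- The expansion `taylor_charFun_two` is for unit variance; a degenerate variable cannot be
  -- rescaled to it and is almost surely zero.
  by_cases hv : Var[X; P] = 0
  · have h1 : X =ᵐ[P] fun _ => (0 : ℝ) := by
      filter_upwards [ae_eq_integral_of_variance_eq_zero hX hv] with ω hω
      rw [hω, h0]
    have h2 : ∀ t : ℝ, charFun (P.map X) t - (1 - (Var[X; P] : ℂ) * t ^ 2 / 2) = 0 := by
      intro t
      rw [Measure.map_congr h1]
      simp [hv]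
    simp_rw [h2]
    exact Asymptotics.isLittleO_zero _ _
  · have hvp : 0 < Var[X; P] := lt_of_le_of_ne (variance_nonneg _ _) (Ne.symm hv)
    set σ : ℝ := √Var[X; P]
    have hσp : 0 < σ := Real.sqrt_pos.2 hvp
    have hσ2 : σ ^ 2 = Var[X; P] := Real.sq_sqrt hvp.le
    have hZ : AEMeasurable (fun ω => σ⁻¹ * X ω) P := hm.const_mul _
    have e0 : P[fun ω => σ⁻¹ * X ω] = 0 := by rw [integral_const_mul, h0, mul_zero]
    have e1 : P[(fun ω => σ⁻¹ * X ω) ^ 2] = 1 := by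
      simp only [Pi.pow_apply, mul_pow]
      rw [integral_const_mul]
      have : ∫ ω, X ω ^ 2 ∂P = Var[X; P] := by
        rw [variance_eq_integral hm, h0]; simp
      rw [this, ← hσ2]
      field_simp
    have key := taylor_charFun_two hZ e0 e1
    have ht : Tendsto (fun t : ℝ => σ * t) (𝓝 0) (𝓝 0) := by
      have : Continuous fun t : ℝ => σ * t := by fun_prop
      simpa using this.tendsto 0
    have key2 := key.comp_tendsto ht
    refine Asymptotics.IsLittleO.of_const_mul_right (c := σ ^ 2) ?_
    convert! key2 using 2 with t t
    · simp only [Function.comp]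
      rw [charFun_map_mul_comp hm, ← hσ2]
      have : σ⁻¹ * (σ * t) = t := by field_simp
      rw [this]
      push_cast
      ring
    · simp [mul_pow]

/-- Controlling `n (φ(t/√n) - 1)` rather than `φ(t/√n)ⁿ` leaves the exponent free, so that `φ` can
later be raised to the block lengths `r n` and `n - r n`. -/
lemma tendsto_mul_charFun_sub_one {Ω : Type*} [MeasurableSpace Ω] {P : Measure Ω}
    [IsProbabilityMeasure P] {X : Ω → ℝ} (hX : MemLp X 2 P) (h0 : ∫ ω, X ω ∂P = 0) (t : ℝ) :
    Tendsto (fun n : ℕ => (n : ℂ) * (charFun (P.map X) ((√(n : ℝ))⁻¹ * t) - 1)) atTop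
      (𝓝 (-(Var[X; P] * t ^ 2 / 2 : ℂ))) := by
  have ht : Tendsto (fun n : ℕ => (√(n : ℝ))⁻¹ * t) atTop (𝓝 0) := by
    rw [← zero_mul t]
    exact .mul_const t (tendsto_inv_atTop_zero.comp <| Real.tendsto_sqrt_atTop.comp <|
      tendsto_natCast_atTop_atTop)
  have key := (charFun_sub_isLittleO hX h0).comp_tendsto ht
  have key2 : (fun n : ℕ => charFun (P.map X) ((√(n : ℝ))⁻¹ * t) -
      (1 - (Var[X; P] : ℂ) * (((√(n : ℝ))⁻¹ * t : ℝ) : ℂ) ^ 2 / 2)) =o[atTop]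
      fun n : ℕ => ((n : ℝ)⁻¹ : ℝ) := by
    refine Asymptotics.IsLittleO.of_const_mul_right (c := t ^ 2) ?_
    refine key.congr_right fun n => ?_
    simp only [Function.comp, mul_pow, inv_pow, Real.sq_sqrt (Nat.cast_nonneg n)]
    ring
  have key3 := key2.tendsto_inv_smul_nhds_zero
  rw [← zero_add (-(Var[X; P] * t ^ 2 / 2 : ℂ))]
  refine (key3.add_const _).congr' ?_
  filter_upwards [eventually_ne_atTop 0] with n hn
  have hn' : (n : ℂ) ≠ 0 := by exact_mod_cast hn
  have : (((√(n : ℝ))⁻¹ * t : ℝ) : ℂ) ^ 2 = (n : ℂ)⁻¹ * t ^ 2 := by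
    rw [← Complex.ofReal_pow]
    simp only [mul_pow, inv_pow, Real.sq_sqrt (Nat.cast_nonneg n)]
    push_cast
    rfl
  rw [this, inv_inv, Complex.real_smul]
  push_cast
  field_simp
  ring

/-- If `n * (z n - 1)` converges to `c` and `k n / n` converges to `δ`, then `z n ^ k n`
converges to `exp (δ * c)`. -/
lemma tendsto_pow_of_tendsto_mul_sub_one {z : ℕ → ℂ} {c : ℂ} {k : ℕ → ℕ} {δ : ℝ}
    (hz : Tendsto (fun n : ℕ => (n : ℂ) * (z n - 1)) atTop (𝓝 c))
    (hk : Tendsto (fun n : ℕ => (k n : ℝ) / n) atTop (𝓝 δ)) :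
    Tendsto (fun n => z n ^ k n) atTop (𝓝 (Complex.exp (δ * c))) := by
  have h1 := Complex.tendsto_nat_mul_log_one_add_of_tendsto hz
  have hk' : Tendsto (fun n : ℕ => (((k n : ℝ) / n : ℝ) : ℂ)) atTop (𝓝 (δ : ℂ)) :=
    (Complex.continuous_ofReal.tendsto δ).comp hk
  have h2 := (Complex.continuous_exp.tendsto _).comp (hk'.mul h1)
  -- Needed only to have `z n ≠ 0` eventually, so that `z n = exp (log (z n))`.
  have hz1 : Tendsto (fun n => z n - 1) atTop (𝓝 0) := by
    have : Tendsto (fun n : ℕ => (n : ℂ)⁻¹ * ((n : ℂ) * (z n - 1))) atTop (𝓝 (0 * c)) :=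
      (tendsto_inv_atTop_nhds_zero_nat (𝕜 := ℂ)).mul hz
    rw [zero_mul] at this
    refine this.congr' ?_
    filter_upwards [eventually_ne_atTop 0] with n hn
    have hn' : (n : ℂ) ≠ 0 := by exact_mod_cast hn
    field_simp
  refine h2.congr' ?_
  filter_upwards [eventually_ne_atTop 0, hz1.eventually_ne (show (0 : ℂ) ≠ -1 by simp)]
    with n hn hzn
  have hn' : (n : ℂ) ≠ 0 := by exact_mod_cast hn
  have hzz : z n ≠ 0 := by
    intro h
    exact hzn (by rw [h]; ring)
  simp only [Function.comp, add_sub_cancel]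
  push_cast
  rw [show ((k n : ℂ) / n) * (n * Complex.log (z n)) = k n * Complex.log (z n) by field_simp,
    Complex.exp_nat_mul, Complex.exp_log hzz]

/-- Central limit theorem for a sum of two blocks: the first `r n` summands are values of `u`, the
remaining `n - r n` are values of `v`, at independent and identically distributed arguments. -/
theorem tendstoInDistribution_two_blocks {Ω T : Type*} [MeasurableSpace Ω] [MeasurableSpace T]
    {μ : Measure Ω} [IsProbabilityMeasure μ] {W : ℕ → Ω → T} (hindep : iIndepFun W μ)
    (hident : ∀ i, IdentDistrib (W i) (W 0) μ μ) {u v : T → ℝ} (hu : Measurable u)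
    (hv : Measurable v) (hu2 : MemLp (fun ω => u (W 0 ω)) 2 μ)
    (hv2 : MemLp (fun ω => v (W 0 ω)) 2 μ) (hu0 : ∫ ω, u (W 0 ω) ∂μ = 0)
    (hv0 : ∫ ω, v (W 0 ω) ∂μ = 0) {r : ℕ → ℕ} (hr : ∀ n, r n ≤ n) {γ : ℝ}
    (hrγ : Tendsto (fun n : ℕ => (r n : ℝ) / n) atTop (𝓝 γ)) {s : ℝ} (hs0 : 0 ≤ s)
    (hs : s = γ * Var[fun ω => u (W 0 ω); μ] + (1 - γ) * Var[fun ω => v (W 0 ω); μ]) :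
    TendstoInDistribution (fun (n : ℕ) ω => (√(n : ℝ))⁻¹ *
      (∑ i ∈ Finset.range (r n), u (W i ω) + ∑ i ∈ Finset.Ico (r n) n, v (W i ω))) atTop
      (id : ℝ → ℝ) (fun _ => μ) (gaussianReal 0 s.toNNReal) := by
  have hWm : ∀ i, AEMeasurable (W i) μ := fun i => (hident i).aemeasurable_fst
  -- As a single sum with an index-dependent summand, both blocks are covered by one family of
  -- independent variables, and the characteristic function factors at once.
  have hsum : ∀ n ω, ∑ i ∈ Finset.range (r n), u (W i ω) + ∑ i ∈ Finset.Ico (r n) n, v (W i ω) =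
      ∑ i ∈ Finset.range n, (if i < r n then u else v) (W i ω) := by
    intro n ω
    rw [← Finset.sum_range_add_sum_Ico _ (hr n)]
    congr 1
    · exact Finset.sum_congr rfl fun i hi => by rw [if_pos (Finset.mem_range.1 hi)]
    · exact Finset.sum_congr rfl fun i hi => by
        rw [if_neg (not_lt.2 (Finset.mem_Ico.1 hi).1)]
  simp_rw [hsum]
  have hfm : ∀ n i, Measurable (if i < r n then u else v) := fun n i => by split_ifs <;> assumption
  have hcm : ∀ n i, AEMeasurable (fun ω => (if i < r n then u else v) (W i ω)) μ := fun n i =>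
    (hfm n i).comp_aemeasurable (hWm i)
  refine ⟨fun n => (Finset.aemeasurable_fun_sum _ fun i _ => hcm n i).const_mul _, by fun_prop, ?_⟩
  refine ProbabilityMeasure.tendsto_iff_tendsto_charFun.2 fun t => ?_
  simp only [ProbabilityMeasure.coe_mk, Measure.map_id]
  have hchar : ∀ n : ℕ, charFun (μ.map fun ω => (√(n : ℝ))⁻¹ *
      ∑ i ∈ Finset.range n, (if i < r n then u else v) (W i ω)) t =
      charFun (μ.map fun ω => u (W 0 ω)) ((√(n : ℝ))⁻¹ * t) ^ r n *
      charFun (μ.map fun ω => v (W 0 ω)) ((√(n : ℝ))⁻¹ * t) ^ (n - r n) := by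
    intro n
    have hind : iIndepFun (fun i ω => (if i < r n then u else v) (W i ω)) μ :=
      hindep.comp (fun i => if i < r n then u else v) (hfm n)
    rw [charFun_map_mul_comp (Finset.aemeasurable_fun_sum _ fun i _ => hcm n i),
      (hind.restrict _).charFun_map_fun_finsetSum_eq_prod (fun i _ => hcm n i),
      Finset.prod_apply, ← Finset.prod_range_mul_prod_Ico _ (hr n)]
    congr 1
    · rw [Finset.prod_congr rfl (g := fun _ => charFun (μ.map fun ω => u (W 0 ω))
        ((√(n : ℝ))⁻¹ * t))]
      · simp
      · intro i hi
        simp only [if_pos (Finset.mem_range.1 hi)]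
        exact congrArg (fun ν => charFun ν ((√(n : ℝ))⁻¹ * t)) ((hident i).comp hu).map_eq
    · rw [Finset.prod_congr rfl (g := fun _ => charFun (μ.map fun ω => v (W 0 ω))
        ((√(n : ℝ))⁻¹ * t))]
      · simp
      · intro i hi
        simp only [if_neg (not_lt.2 (Finset.mem_Ico.1 hi).1)]
        exact congrArg (fun ν => charFun ν ((√(n : ℝ))⁻¹ * t)) ((hident i).comp hv).map_eq
  simp_rw [hchar]
  have hnr : Tendsto (fun n : ℕ => ((n - r n : ℕ) : ℝ) / n) atTop (𝓝 (1 - γ)) := by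
    refine (hrγ.const_sub 1).congr' ?_
    filter_upwards [eventually_ne_atTop 0] with n hn
    have hn' : (n : ℝ) ≠ 0 := by exact_mod_cast hn
    rw [Nat.cast_sub (hr n)]
    field_simp
  have h1 := tendsto_pow_of_tendsto_mul_sub_one (tendsto_mul_charFun_sub_one hu2 hu0 t) hrγ
  have h2 := tendsto_pow_of_tendsto_mul_sub_one (tendsto_mul_charFun_sub_one hv2 hv0 t) hnr
  convert! h1.mul h2 using 2
  rw [charFun_gaussianReal, ← Complex.exp_add]
  congr 1
  rw [Real.coe_toNNReal _ hs0, hs]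
  push_cast
  ring

end Unlabeled

/-! ### Uniform strong law and measurability of derivatives -/

namespace Unlabeled

/-- By the Lindelöf property every open set is a countable union of balls, and preimages of balls
are measurable by hypothesis. It serves for the Borel structure of a space of continuous functions.
-/
lemma measurable_of_measurable_dist {T F : Type*} [MeasurableSpace T] [PseudoMetricSpace F]
    [SecondCountableTopology F] [MeasurableSpace F] [BorelSpace F] {f : T → F}
    (h : ∀ x, Measurable fun t => dist (f t) x) : Measurable f := by
  refine measurable_of_isOpen fun O hO => ?_
  choose! ρ hρ hρO using Metric.isOpen_iff.1 hO
  obtain ⟨S, hSc, hS⟩ := TopologicalSpace.isOpen_iUnion_countable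
    (fun x : O => Metric.ball (x : F) (ρ x)) fun _ => Metric.isOpen_ball
  have hcov : O = ⋃ x ∈ S, Metric.ball (x : F) (ρ x) := by
    rw [hS]
    refine Set.Subset.antisymm (fun x hx => ?_) (Set.iUnion_subset fun x => hρO x x.2)
    exact Set.mem_iUnion.2 ⟨⟨x, hx⟩, Metric.mem_ball_self (hρ x hx)⟩
  rw [hcov, Set.preimage_iUnion₂]
  exact MeasurableSet.biUnion hSc fun x _ => measurableSet_lt (h x) measurable_const

/-- A random continuous function on a compact space is measurable if its values are. -/
lemma measurable_continuousMap_of_eval {T Z F : Type*} [MeasurableSpace T] [PseudoMetricSpace Z]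
    [CompactSpace Z] [PseudoMetricSpace F] [SecondCountableTopology F] [MeasurableSpace F]
    [BorelSpace F] [MeasurableSpace C(Z, F)] [BorelSpace C(Z, F)] {f : T → C(Z, F)}
    (h : ∀ z, Measurable fun t => f t z) : Measurable f := by
  refine measurable_of_measurable_dist fun x => measurable_of_Iic fun c => ?_
  rcases lt_or_ge c 0 with hc | hc
  · convert MeasurableSet.empty
    ext t
    simpa using hc.trans_le dist_nonneg
  · obtain ⟨S, hSc, hS⟩ := TopologicalSpace.exists_countable_dense Z
    -- By continuity, a sup-distance bound need only be checked on a countable dense set.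
    have : (fun t => dist (f t) x) ⁻¹' Set.Iic c = ⋂ z ∈ S, {t | dist (f t z) (x z) ≤ c} := by
      ext t
      simp only [Set.mem_preimage, Set.mem_Iic, Set.mem_iInter, Set.mem_ofPred_eq]
      rw [ContinuousMap.dist_le hc]
      refine ⟨fun h z _ => h z, fun h z => ?_⟩
      have hcl : IsClosed {z | dist (f t z) (x z) ≤ c} :=
        isClosed_le (by fun_prop) continuous_const
      exact hcl.closure_subset_iff.2 h (hS z)
    rw [this]
    exact MeasurableSet.biInter hSc fun z _ =>
      measurableSet_le ((h z).dist measurable_const) measurable_const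

/-- Uniform strong law of large numbers over a compact parameter set. -/
theorem uniform_strong_law {Ω T E F : Type*} [MeasurableSpace Ω] [MeasurableSpace T]
    {μ : Measure Ω} [IsProbabilityMeasure μ] [PseudoMetricSpace E]
    [NormedAddCommGroup F] [NormedSpace ℝ F] [CompleteSpace F] [SecondCountableTopology F]
    [MeasurableSpace F] [BorelSpace F] {W : ℕ → Ω → T} (hindep : iIndepFun W μ)
    (hident : ∀ i, IdentDistrib (W i) (W 0) μ μ) {G : Set T} (hG : MeasurableSet G)
    (hWG : ∀ᵐ ω ∂μ, W 0 ω ∈ G) {K : Set E} (hK : IsCompact K) {Q : T → E → F} {H : T → ℝ}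
    (hQm : ∀ ϑ ∈ K, Measurable (G.indicator fun t => Q t ϑ))
    (hQc : ∀ t ∈ G, ContinuousOn (Q t) K) (hH : Integrable (fun ω => H (W 0 ω)) μ)
    (hQH : ∀ t ∈ G, ∀ ϑ ∈ K, ‖Q t ϑ‖ ≤ H t) :
    (∀ᵐ ω ∂μ, TendstoUniformlyOn
      (fun (n : ℕ) ϑ => (n : ℝ)⁻¹ • ∑ i ∈ Finset.range n, Q (W i ω) ϑ)
      (fun ϑ => ∫ ω, Q (W 0 ω) ϑ ∂μ) atTop K) ∧
    ContinuousOn (fun ϑ => ∫ ω, Q (W 0 ω) ϑ ∂μ) K := by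
  classical
  have : CompactSpace K := isCompact_iff_compactSpace.1 hK
  let _ : MeasurableSpace C(K, F) := borel _
  have : BorelSpace C(K, F) := ⟨rfl⟩
  have hWm : ∀ i, AEMeasurable (W i) μ := fun i => (hident i).aemeasurable_fst
  -- The summands become random elements of the Banach space `C(K, F)`. The strong law there is
  -- convergence in sup norm, and the continuity of the mean comes for free because the mean is an
  -- element of `C(K, F)`.
  let Φ : T → C(K, F) := fun t =>
    if h : t ∈ G then ⟨fun z => Q t z, (hQc t h).domRestrict⟩ else 0
  have hΦ : ∀ t ∈ G, ∀ z : K, Φ t z = Q t z := fun t ht z => by simp only [Φ, dif_pos ht]; rfl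
  have hΦm : Measurable Φ := by
    refine measurable_continuousMap_of_eval fun z => ?_
    convert hQm z z.2 using 1
    ext t
    by_cases ht : t ∈ G
    · rw [hΦ t ht, Set.indicator_of_mem ht]
    · simp [Φ, ht]
  have hall : ∀ᵐ ω ∂μ, ∀ i, W i ω ∈ G := by
    rw [ae_all_iff]
    exact fun i => (hident i).symm.ae_snd hG hWG
  have hΦi : Integrable (fun ω => Φ (W 0 ω)) μ := by
    refine hH.norm.mono' (hΦm.comp_aemeasurable (hWm 0)).aestronglyMeasurable ?_
    filter_upwards [hWG] with ω hω
    refine (ContinuousMap.norm_le _ (norm_nonneg _)).2 fun z => ?_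
    rw [hΦ _ hω]
    exact (hQH _ hω z z.2).trans (le_abs_self _)
  have hint : ∀ z : K, (∫ ω, Φ (W 0 ω) ∂μ) z = ∫ ω, Q (W 0 ω) z ∂μ := by
    intro z
    rw [ContinuousMap.integral_apply hΦi]
    refine integral_congr_ae ?_
    filter_upwards [hWG] with ω hω
    exact hΦ _ hω z
  have hlaw := strong_law_ae (fun i ω => Φ (W i ω)) hΦi
    (fun i j hij => (hindep.indepFun hij).comp hΦm hΦm) (fun i => (hident i).comp hΦm)
  refine ⟨?_, ?_⟩
  · filter_upwards [hlaw, hall] with ω hω hωG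
    rw [ContinuousMap.tendsto_iff_tendstoUniformly] at hω
    rw [tendstoUniformlyOn_iff_tendstoUniformly_comp_coe]
    convert! hω using 1
    · ext n z
      simp [hΦ _ (hωG _)]
    · ext z
      exact (hint z).symm
  · rw [continuousOn_iff_continuous_domRestrict]
    convert! (∫ ω, Φ (W 0 ω) ∂μ).continuous using 1
    ext z
    exact (hint z).symm

/-- The derivative in the parameter is measurable in the argument. -/
lemma measurable_indicator_fderiv {T E F : Type*} [MeasurableSpace T] [NormedAddCommGroup E]
    [NormedSpace ℝ E] [FiniteDimensional ℝ E] [NormedAddCommGroup F] [NormedSpace ℝ F]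
    [SecondCountableTopology F] [MeasurableSpace F] [BorelSpace F] {G : Set T}
    {U : Set E} (hU : IsOpen U) {Q : T → E → F}
    (hQm : ∀ ϑ ∈ U, Measurable (G.indicator fun t => Q t ϑ)) {ϑ : E} (hϑ : ϑ ∈ U)
    (hQd : ∀ t ∈ G, DifferentiableAt ℝ (Q t) ϑ) :
    Measurable (G.indicator fun t => fderiv ℝ (Q t) ϑ) := by
  have happ : ∀ v : E, Measurable (G.indicator fun t => fderiv ℝ (Q t) ϑ v) := by
    intro v
    have hlim : Tendsto (fun n : ℕ => ϑ + ((n : ℝ)⁻¹) • v) atTop (𝓝 ϑ) := by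
      have := ((tendsto_inv_atTop_nhds_zero_nat (𝕜 := ℝ)).smul_const v).const_add ϑ
      simpa using this
    -- Difference quotients with step `1/n` are measurable only once `ϑ + v/n` lies in `U`, hence
    -- the shift by `N`.
    obtain ⟨N, hN⟩ := eventually_atTop.1 (hlim.eventually (hU.mem_nhds hϑ))
    refine measurable_of_tendsto_metrizable
      (f := fun n : ℕ => ((n + N : ℕ) : ℝ) • (G.indicator (fun t => Q t
        (ϑ + (((n + N : ℕ) : ℝ)⁻¹) • v)) - G.indicator (fun t => Q t ϑ))) (fun n => ?_) ?_
    · exact ((hQm _ (hN _ (Nat.le_add_left _ _))).sub (hQm _ hϑ)).const_smul _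
    · rw [tendsto_pi_nhds]
      intro t
      by_cases ht : t ∈ G
      · simp only [Pi.smul_apply, Pi.sub_apply, Set.indicator_of_mem ht]
        have h1 := (hQd t ht).hasFDerivAt.lim_real v
        exact h1.comp (tendsto_natCast_atTop_atTop.comp (tendsto_add_atTop_nat N))
      · simp [ht]
  let e := Module.finBasis ℝ E
  -- A linear map is determined by its values on a basis, so directional derivatives suffice.
  have hrep : (G.indicator fun t => fderiv ℝ (Q t) ϑ) = fun t => ∑ i,
      (LinearMap.toContinuousLinearMap (e.coord i)).smulRight
        (G.indicator (fun t => fderiv ℝ (Q t) ϑ (e i)) t) := by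
    ext t v
    by_cases ht : t ∈ G
    · simp only [Set.indicator_of_mem ht]
      conv_lhs => rw [← e.sum_repr v, map_sum]
      simp only [map_smul, sum_apply, ContinuousLinearMap.smulRight_apply,
        LinearMap.coe_toContinuousLinearMap', Module.Basis.coord_apply]
    · simp [ht]
  rw [hrep]
  refine Finset.measurable_fun_sum _ fun i _ => ?_
  exact (ContinuousLinearMap.smulRightL ℝ E F
    (LinearMap.toContinuousLinearMap (e.coord i))).continuous.measurable.comp (happ (e i))

end Unlabeled

/-! ### Deterministic linearization at roots of the estimating equation -/

namespace Unlabeled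

/-- Roots of functions that converge uniformly on a compact set approach the only root of the
limit. -/
lemma eventually_dist_root_lt {ι E F : Type*} {l : Filter ι} [MetricSpace E]
    [NormedAddCommGroup F] {K : Set E} (hK : IsCompact K) {Ψ : ι → E → F} {Ψ₀ : E → F} {θ : E}
    (hΨ : TendstoUniformlyOn Ψ Ψ₀ l K) (hc : ContinuousOn Ψ₀ K)
    (hid : ∀ ϑ ∈ K, Ψ₀ ϑ = 0 → ϑ = θ) {δ : ℝ} (hδ : 0 < δ) :
    ∀ᶠ n in l, ∀ ϑ ∈ K, Ψ n ϑ = 0 → dist ϑ θ < δ := by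
  have hKδ : IsCompact (K \ Metric.ball θ δ) := hK.diff Metric.isOpen_ball
  rcases (K \ Metric.ball θ δ).eq_empty_or_nonempty with he | hne
  · refine Eventually.of_forall fun n ϑ hϑ _ => ?_
    by_contra hd
    exact Set.notMem_empty ϑ (he ▸ ⟨hϑ, hd⟩)
  · obtain ⟨ϑ₀, hϑ₀, hmin⟩ := hKδ.exists_isMinOn hne (hc.mono Set.sdiff_subset).norm
    -- The minimum of `‖Ψ₀‖` outside the ball is positive, and a uniform error below it excludes
    -- roots there.
    have hpos : 0 < ‖Ψ₀ ϑ₀‖ := by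
      rw [norm_pos_iff]
      intro h
      apply hϑ₀.2
      rw [hid ϑ₀ hϑ₀.1 h]
      exact Metric.mem_ball_self hδ
    filter_upwards [Metric.tendstoUniformlyOn_iff.1 hΨ _ hpos] with n hn ϑ hϑ h0
    by_contra hd
    have h1 := hn ϑ hϑ
    rw [h0, dist_zero_right] at h1
    exact absurd (hmin ⟨hϑ, hd⟩) (not_le.2 h1)

/-- First-order expansion at `θ`, uniform along a sequence of functions whose derivatives converge
uniformly near `θ`. -/
lemma eventually_norm_sub_sub_le {ι E F : Type*} {l : Filter ι} [NormedAddCommGroup E]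
    [NormedSpace ℝ E] [NormedAddCommGroup F] [NormedSpace ℝ F] {K : Set E} {θ : E}
    (hθ : θ ∈ interior K) {Ψ : ι → E → F} {D : ι → E → E →L[ℝ] F} {D₀ : E → E →L[ℝ] F}
    (hd : ∀ᶠ n in l, ∀ ϑ ∈ K, HasFDerivAt (Ψ n) (D n ϑ) ϑ) (hD : TendstoUniformlyOn D D₀ l K)
    (hc : ContinuousOn D₀ K) {ε : ℝ} (hε : 0 < ε) :
    ∃ δ > 0, ∀ᶠ n in l, ∀ ϑ ∈ Metric.ball θ δ,
      ‖Ψ n ϑ - Ψ n θ - D₀ θ (ϑ - θ)‖ ≤ ε * ‖ϑ - θ‖ := by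
  have hKθ : K ∈ 𝓝 θ := mem_interior_iff_mem_nhds.1 hθ
  have hcθ : ContinuousAt D₀ θ := hc.continuousAt hKθ
  obtain ⟨δ, hδ, hδs⟩ := Metric.mem_nhds_iff.1
    (inter_mem hKθ (hcθ.preimage_mem_nhds (Metric.ball_mem_nhds _ (half_pos hε))))
  refine ⟨δ, hδ, ?_⟩
  filter_upwards [Metric.tendstoUniformlyOn_iff.1 hD _ (half_pos hε), hd] with n hn hdn ϑ hϑ
  -- Mean value inequality: on the ball, `D n` differs from `D₀ θ` by at most `ε/2` from uniform
  -- convergence and `ε/2` from continuity of `D₀`.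
  refine (convex_ball θ δ).norm_image_sub_le_of_norm_hasFDerivWithin_le'
    (f' := D n) (fun x hx => (hdn x (hδs hx).1).hasFDerivWithinAt) (fun x hx => ?_)
    (Metric.mem_ball_self hδ) hϑ
  have h1 := hn x (hδs hx).1
  have h2 : dist (D₀ x) (D₀ θ) < ε / 2 := (hδs hx).2
  rw [dist_eq_norm] at h1 h2
  calc ‖D n x - D₀ θ‖ = ‖(D₀ x - D₀ θ) - (D₀ x - D n x)‖ := by congr 1; abel
    _ ≤ ‖D₀ x - D₀ θ‖ + ‖D₀ x - D n x‖ := norm_sub_le _ _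
    _ ≤ ε := by linarith

/-- Linearization of a plug-in functional `Γ n` at a root of the estimating equation `Ψ n = 0`. -/
theorem eventually_plugin_linearization {ι E F : Type*} {l : Filter ι} [NormedAddCommGroup E]
    [NormedSpace ℝ E] [NormedAddCommGroup F] [NormedSpace ℝ F] {K : Set E}
    (hK : IsCompact K) {θ : E} (hθ : θ ∈ interior K)
    {Ψ : ι → E → F} {Ψ₀ : E → F} {D : ι → E → E →L[ℝ] F} {D₀ : E → E →L[ℝ] F}
    (hΨ : TendstoUniformlyOn Ψ Ψ₀ l K) (hΨc : ContinuousOn Ψ₀ K)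
    (hid : ∀ ϑ ∈ K, Ψ₀ ϑ = 0 → ϑ = θ)
    (hd : ∀ᶠ n in l, ∀ ϑ ∈ K, HasFDerivAt (Ψ n) (D n ϑ) ϑ) (hD : TendstoUniformlyOn D D₀ l K)
    (hDc : ContinuousOn D₀ K)
    {Γ : ι → E → ℝ} {L : ι → E → E →L[ℝ] ℝ} {L₀ : E → E →L[ℝ] ℝ}
    (hdΓ : ∀ᶠ n in l, ∀ ϑ ∈ K, HasFDerivAt (Γ n) (L n ϑ) ϑ) (hL : TendstoUniformlyOn L L₀ l K)
    (hLc : ContinuousOn L₀ K) {C : ℝ} (hC : 0 < C) (hinv : ∀ v, ‖v‖ ≤ C * ‖D₀ θ v‖)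
    {Λ : F →L[ℝ] ℝ} (hΛ : ∀ v, L₀ θ v = -Λ (D₀ θ v)) {ε : ℝ} (hε : 0 < ε) :
    ∀ᶠ n in l, ∀ ϑ ∈ K, Ψ n ϑ = 0 → |Γ n ϑ - Γ n θ - Λ (Ψ n θ)| ≤ ε * ‖Ψ n θ‖ := by
  -- The first bound lets `η C ‖v‖` be absorbed into the left side when `‖v‖` is estimated by `‖Ψ n
  -- θ‖`; the second makes the final error at most `ε ‖Ψ n θ‖`.
  obtain ⟨η, hη, hη1, hη2⟩ : ∃ η > 0, η * C ≤ 1 / 2 ∧ η * (1 + ‖Λ‖) * (2 * C) ≤ ε := by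
    refine ⟨min (1 / (2 * C)) (ε / ((1 + ‖Λ‖) * (2 * C))), by positivity, ?_, ?_⟩
    · calc _ ≤ 1 / (2 * C) * C := by gcongr; exact min_le_left _ _
        _ = 1 / 2 := by field_simp
    · calc _ ≤ ε / ((1 + ‖Λ‖) * (2 * C)) * (1 + ‖Λ‖) * (2 * C) := by
            gcongr; exact min_le_right _ _
        _ = ε := by field_simp
  obtain ⟨δ₁, hδ₁, h1⟩ := eventually_norm_sub_sub_le hθ hd hD hDc hη
  obtain ⟨δ₂, hδ₂, h2⟩ := eventually_norm_sub_sub_le hθ hdΓ hL hLc hη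
  filter_upwards [h1, h2, eventually_dist_root_lt hK hΨ hΨc hid (lt_min hδ₁ hδ₂)]
    with n hn1 hn2 hn3 ϑ hϑ hroot
  have hdist := hn3 ϑ hϑ hroot
  have e1 := hn1 ϑ (hdist.trans_le (min_le_left _ _))
  have e2 := hn2 ϑ (hdist.trans_le (min_le_right _ _))
  rw [hroot, zero_sub] at e1
  set v := ϑ - θ
  set M := D₀ θ v
  have e3 : ‖Ψ n θ + M‖ ≤ η * ‖v‖ := by
    rwa [← norm_neg, neg_add, ← sub_eq_add_neg]
  have e4 : ‖M‖ ≤ ‖Ψ n θ‖ + η * ‖v‖ := by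
    calc ‖M‖ = ‖(Ψ n θ + M) - Ψ n θ‖ := by congr 1; abel
      _ ≤ ‖Ψ n θ + M‖ + ‖Ψ n θ‖ := norm_sub_le _ _
      _ ≤ _ := by linarith
  have e5 : ‖v‖ ≤ 2 * C * ‖Ψ n θ‖ := by
    have h := hinv v
    have h' : C * ‖M‖ ≤ C * (‖Ψ n θ‖ + η * ‖v‖) := by gcongr
    have h'' : η * C * ‖v‖ ≤ 1 / 2 * ‖v‖ := by gcongr
    nlinarith
  have e6 : |Γ n ϑ - Γ n θ - Λ (Ψ n θ)| ≤ η * ‖v‖ + ‖Λ‖ * (η * ‖v‖) := by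
    -- At a root `Ψ n θ ≈ -M`, and `L₀ θ v = -Λ M`, so the increment of `Γ n` is `Λ (Ψ n θ)` up to
    -- the two Taylor remainders.
    have : Γ n ϑ - Γ n θ - Λ (Ψ n θ) =
        (Γ n ϑ - Γ n θ - L₀ θ v) - Λ (Ψ n θ + M) := by
      rw [hΛ, map_add]; ring
    rw [this, ← Real.norm_eq_abs]
    refine (norm_sub_le _ _).trans (add_le_add e2 ((Λ.le_opNorm _).trans ?_))
    gcongr
  calc _ ≤ η * (1 + ‖Λ‖) * ‖v‖ := e6.trans (by ring_nf; rfl)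
    _ ≤ η * (1 + ‖Λ‖) * (2 * C * ‖Ψ n θ‖) := by gcongr
    _ = η * (1 + ‖Λ‖) * (2 * C) * ‖Ψ n θ‖ := by ring
    _ ≤ ε * ‖Ψ n θ‖ := by gcongr

end Unlabeled

/-! ### From pathwise bounds to convergence in probability -/

namespace Unlabeled

/-- A sequence that is bounded in mean square, times a null sequence, tends to zero in
probability. -/
lemma tendstoInMeasure_of_sq_integral_tendsto {Ω : Type*} [MeasurableSpace Ω] {μ : Measure Ω}
    [IsProbabilityMeasure μ] {Z : ℕ → Ω → ℝ} (hZ : ∀ n, MemLp (Z n) 2 μ)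
    (h : Tendsto (fun n => ∫ ω, Z n ω ^ 2 ∂μ) atTop (𝓝 0)) :
    TendstoInMeasure μ Z atTop 0 := by
  rw [tendstoInMeasure_iff_measureReal_norm]
  intro ε hε
  have hle : ∀ n, μ.real {ω | ε ≤ ‖Z n ω - (0 : Ω → ℝ) ω‖} ≤ (∫ ω, Z n ω ^ 2 ∂μ) / ε ^ 2 := by
    intro n
    rw [le_div_iff₀ (by positivity), mul_comm]
    have := mul_meas_ge_le_integral_of_nonneg (μ := μ) (f := fun ω => Z n ω ^ 2)
      (ae_of_all _ fun ω => sq_nonneg _) (hZ n).integrable_sq (ε ^ 2)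
    have he : {ω | ε ^ 2 ≤ Z n ω ^ 2} = {ω | ε ≤ ‖Z n ω - (0 : Ω → ℝ) ω‖} := by
      ext ω
      simp only [Set.mem_ofPred_eq, Pi.zero_apply, sub_zero, Real.norm_eq_abs]
      rw [← sq_abs (Z n ω)]
      exact pow_le_pow_iff_left₀ hε.le (abs_nonneg _) two_ne_zero
    rwa [he] at this
  have h' : Tendsto (fun n => (∫ ω, Z n ω ^ 2 ∂μ) / ε ^ 2) atTop (𝓝 0) := by
    simpa using h.div_const (ε ^ 2)
  exact squeeze_zero (fun n => measureReal_nonneg) hle h'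

/-- If, almost surely and eventually, `R n` is small compared to `S n` on an event `B n` whose
probability tends to one, and `k n • S n` is bounded in mean square, then `k n * R n` tends to zero
in probability. -/
theorem tendstoInMeasure_mul_of_eventually_le {Ω : Type*} [MeasurableSpace Ω] {μ : Measure Ω}
    [IsProbabilityMeasure μ] {R S : ℕ → Ω → ℝ} (hR : ∀ n, AEMeasurable (R n) μ)
    (hS : ∀ n, AEMeasurable (S n) μ) (hS0 : ∀ n ω, 0 ≤ S n ω) {B : ℕ → Set Ω}
    (hB : Tendsto (fun n => μ (B n)ᶜ) atTop (𝓝 0))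
    (hle : ∀ ε > 0, ∀ᵐ ω ∂μ, ∀ᶠ n in atTop, ω ∈ B n → |R n ω| ≤ ε * S n ω) {k : ℕ → ℝ}
    (hk : ∀ n, 0 ≤ k n) {C : ℝ} (hint : ∀ n, Integrable (fun ω => (k n * S n ω) ^ 2) μ)
    (hC : ∀ n, ∫ ω, (k n * S n ω) ^ 2 ∂μ ≤ C) :
    TendstoInMeasure μ (fun n ω => k n * R n ω) atTop 0 := by
  have hBr : Tendsto (fun n => μ.real (B n)ᶜ) atTop (𝓝 0) := by
    have h := (ENNReal.tendsto_toReal ENNReal.zero_ne_top).comp hB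
    rwa [ENNReal.toReal_zero] at h
  rw [tendstoInMeasure_iff_measureReal_norm]
  intro ε hε
  refine tendsto_order.2 ⟨fun a ha => Eventually.of_forall fun n =>
    ha.trans_le measureReal_nonneg, fun δ hδ => ?_⟩
  -- The quantity `C η² / ε²` is the Chebyshev bound for the event `k n * S n ≥ ε / η`.
  obtain ⟨η, hη, hηδ⟩ : ∃ η > 0, C * η ^ 2 / ε ^ 2 < δ / 3 := by
    have hcont : Tendsto (fun η : ℝ => C * η ^ 2 / ε ^ 2) (𝓝[>] 0) (𝓝 0) := by
      have : Continuous fun η : ℝ => C * η ^ 2 / ε ^ 2 := by fun_prop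
      simpa using (this.tendsto 0).mono_left nhdsWithin_le_nhds
    obtain ⟨η, h1, h2⟩ := ((hcont.eventually_lt_const (show (0 : ℝ) < δ / 3 by positivity)).and
      self_mem_nhdsWithin).exists
    exact ⟨η, h2, h1⟩
  -- The part of `B n` where the bound fails. The sets `B n` need not be measurable, so the
  -- complement is replaced by its measurable hull, which has the same measure.
  set N : ℕ → Set Ω := fun n => (toMeasurable μ (B n)ᶜ)ᶜ ∩ {ω | η * S n ω < |R n ω|}
  have hNm : ∀ n, NullMeasurableSet (N n) μ := fun n =>
    (measurableSet_toMeasurable _ _).compl.nullMeasurableSet.inter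
      (nullMeasurableSet_lt ((hS n).const_mul _) (hR n).norm)
  have hN0 : Tendsto (fun n => μ.real (N n)) atTop (𝓝 0) := by
    -- Almost surely only finitely many `N n` occur, so their indicators tend to zero almost surely
    -- and hence in measure.
    have h1 : TendstoInMeasure μ (fun n => (N n).indicator fun _ => (1 : ℝ)) atTop 0 := by
      refine tendstoInMeasure_of_tendsto_ae
        (fun n => (aestronglyMeasurable_const.indicator₀ (hNm n))) ?_
      filter_upwards [hle η hη] with ω hω
      refine tendsto_const_nhds.congr' ?_
      filter_upwards [hω] with n hn
      rw [Set.indicator_of_notMem]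
      · rfl
      · rintro ⟨hn1, hn2⟩
        have hnB : ω ∈ B n := by
          by_contra hc
          exact hn1 (subset_toMeasurable μ _ hc)
        exact absurd (hn hnB) (not_le.2 hn2)
    rw [tendstoInMeasure_iff_measureReal_norm] at h1
    refine (h1 1 one_pos).congr fun n => ?_
    congr 1
    ext ω
    by_cases hω : ω ∈ N n <;> simp [hω]
  have hcheb : ∀ n, μ.real {ω | ε / η ≤ k n * S n ω} ≤ C * η ^ 2 / ε ^ 2 := by
    intro n
    have h := mul_meas_ge_le_integral_of_nonneg (μ := μ) (f := fun ω => (k n * S n ω) ^ 2)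
      (ae_of_all _ fun ω => sq_nonneg _) (hint n) ((ε / η) ^ 2)
    have he : {ω | (ε / η) ^ 2 ≤ (k n * S n ω) ^ 2} = {ω | ε / η ≤ k n * S n ω} := by
      ext ω
      exact pow_le_pow_iff_left₀ (by positivity) (mul_nonneg (hk n) (hS0 n ω)) two_ne_zero
    rw [he] at h
    have h' := h.trans (hC n)
    rw [div_pow, div_mul_eq_mul_div, div_le_iff₀ (by positivity)] at h'
    rw [le_div_iff₀ (by positivity)]
    linarith
  filter_upwards [hN0.eventually_lt_const (show (0 : ℝ) < δ / 3 by positivity),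
    hBr.eventually_lt_const (show (0 : ℝ) < δ / 3 by positivity)] with n hn1 hn2
  have hsub : {ω | ε ≤ ‖k n * R n ω - (0 : Ω → ℝ) ω‖} ⊆
      (toMeasurable μ (B n)ᶜ ∪ N n) ∪ {ω | ε / η ≤ k n * S n ω} := by
    intro ω hω
    by_contra hc
    simp only [Set.mem_union, not_or] at hc
    obtain ⟨⟨hc1, hc2⟩, hc3⟩ := hc
    have h1 : |R n ω| ≤ η * S n ω := by
      by_contra hlt
      exact hc2 ⟨hc1, not_le.1 hlt⟩
    have h2 : ε ≤ k n * |R n ω| := by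
      have : ε ≤ ‖k n * R n ω - 0‖ := hω
      rwa [sub_zero, Real.norm_eq_abs, abs_mul, abs_of_nonneg (hk n)] at this
    apply hc3
    change ε / η ≤ k n * S n ω
    rw [div_le_iff₀ hη]
    have h3 := mul_le_mul_of_nonneg_left h1 (hk n)
    linarith
  have hT : μ.real (toMeasurable μ (B n)ᶜ) = μ.real (B n)ᶜ := by
    simp only [measureReal_def, measure_toMeasurable]
  have h4 := measureReal_mono (μ := μ) hsub
  have h5 := measureReal_union_le (μ := μ) (toMeasurable μ (B n)ᶜ ∪ N n)
    {ω | ε / η ≤ k n * S n ω}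
  have h6 := measureReal_union_le (μ := μ) (toMeasurable μ (B n)ᶜ) (N n)
  have h7 := hcheb n
  linarith

end Unlabeled

/-! ### Conditioning on the feature -/

namespace Unlabeled

/-- The law of `X` on an event whose conditional probability given `X` is `k X` has density `k`
with respect to the law of `X`. -/
lemma map_restrict_eq_withDensity {Ω 𝓧 : Type*} [mΩ : MeasurableSpace Ω] [m𝓧 : MeasurableSpace 𝓧]
    {μ : Measure Ω} [IsProbabilityMeasure μ] {X : Ω → 𝓧} (hX : Measurable X) {S : Set Ω}
    (hS : MeasurableSet S) {k : 𝓧 → ℝ} (hk : Measurable k) (hk0 : ∀ᵐ ω ∂μ, 0 ≤ k (X ω))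
    (hcond : μ⟦S | MeasurableSpace.comap X m𝓧⟧ =ᵐ[μ] fun ω => k (X ω)) :
    (μ.restrict S).map X = (μ.map X).withDensity fun t => ENNReal.ofReal (k t) := by
  ext A hA
  have hm : MeasurableSpace.comap X m𝓧 ≤ mΩ := hX.comap_le
  have hXA : MeasurableSet (X ⁻¹' A) := hX hA
  rw [Measure.map_apply hX hA, Measure.restrict_apply hXA, withDensity_apply _ hA,
    setLIntegral_map hA (by fun_prop) hX]
  have hint : Integrable (fun ω => k (X ω)) μ := integrable_condExp.congr hcond
  -- The defining property of conditional expectation, tested on the event `X ∈ A`.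
  have h1 : ∫ ω in X ⁻¹' A, (S.indicator (fun _ => (1 : ℝ))) ω ∂μ =
      ∫ ω in X ⁻¹' A, k (X ω) ∂μ := by
    rw [← setIntegral_condExp hm ((integrable_const (1 : ℝ)).indicator hS) ⟨A, hA, rfl⟩]
    exact integral_congr_ae (ae_restrict_of_ae hcond)
  rw [← ofReal_integral_eq_lintegral_ofReal hint.integrableOn (ae_restrict_of_ae hk0), ← h1,
    setIntegral_indicator hS]
  simp

/-- Expectation of a function of a feature and a class indicator, by conditioning on the
feature. -/
theorem integral_indicator_cond {Ω 𝓧 E : Type*} [mΩ : MeasurableSpace Ω]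
    [m𝓧 : MeasurableSpace 𝓧] {μ : Measure Ω} [IsProbabilityMeasure μ] [NormedAddCommGroup E]
    [NormedSpace ℝ E] {X : Ω → 𝓧} (hX : Measurable X) {y : Ω → ℝ} (hy : Measurable y)
    (hy01 : ∀ ω, y ω = 0 ∨ y ω = 1) {k : 𝓧 → ℝ} (hk : Measurable k)
    (hk01 : ∀ᵐ ω ∂μ, k (X ω) ∈ Set.Icc (0 : ℝ) 1)
    (hcond : μ⟦{ω | y ω = 1} | MeasurableSpace.comap X m𝓧⟧ =ᵐ[μ] fun ω => k (X ω))
    {Q : 𝓧 → ℝ → E} (hQ1 : AEStronglyMeasurable (fun t => Q t 1) (μ.map X))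
    (hQ0 : AEStronglyMeasurable (fun t => Q t 0) (μ.map X))
    (hi1 : Integrable (fun ω => k (X ω) • Q (X ω) 1) μ)
    (hi0 : Integrable (fun ω => (1 - k (X ω)) • Q (X ω) 0) μ) :
    Integrable (fun ω => Q (X ω) (y ω)) μ ∧ ∫ ω, Q (X ω) (y ω) ∂μ =
      ∫ ω, (k (X ω) • Q (X ω) 1 + (1 - k (X ω)) • Q (X ω) 0) ∂μ := by
  set S : Set Ω := {ω | y ω = 1}
  have hS : MeasurableSet S := hy (measurableSet_singleton 1)
  have hm : MeasurableSpace.comap X m𝓧 ≤ mΩ := hX.comap_le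
  -- One statement for both labels: it is used with density `k` on `{y = 1}` and with density `1 -
  -- k` on the complement.
  have part : ∀ (A : Set Ω) (q : 𝓧 → ℝ) (h : 𝓧 → E) (c : ℝ), MeasurableSet A → Measurable q →
      (∀ᵐ ω ∂μ, 0 ≤ q (X ω)) →
      μ⟦A | MeasurableSpace.comap X m𝓧⟧ =ᵐ[μ] (fun ω => q (X ω)) →
      AEStronglyMeasurable h (μ.map X) → Integrable (fun ω => q (X ω) • h (X ω)) μ →
      (∀ ω ∈ A, y ω = c) → h = (fun t => Q t c) →
      IntegrableOn (fun ω => Q (X ω) (y ω)) A μ ∧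
      ∫ ω in A, Q (X ω) (y ω) ∂μ = ∫ ω, q (X ω) • h (X ω) ∂μ := by
    intro A q h c hA hq hq0 hcA hh hi hyA hhQ
    have hd := map_restrict_eq_withDensity hX hA hq hq0 hcA
    have hac : (μ.restrict A).map X ≪ μ.map X := by
      rw [hd]; exact withDensity_absolutelyContinuous _ _
    have hh' : AEStronglyMeasurable h ((μ.restrict A).map X) := hh.mono_ac hac
    have hqm : AEMeasurable (fun t => ENNReal.ofReal (q t)) (μ.map X) := by fun_prop
    have hq0' : ∀ᵐ t ∂(μ.map X), 0 ≤ q t :=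
      (ae_map_iff hX.aemeasurable (measurableSet_le measurable_const hq)).2 hq0
    have heq : (fun t => (ENNReal.ofReal (q t)).toReal • h t) =ᵐ[μ.map X] fun t => q t • h t := by
      filter_upwards [hq0'] with t ht
      rw [ENNReal.toReal_ofReal ht]
    have hqh : AEStronglyMeasurable (fun t => q t • h t) (μ.map X) :=
      hq.aestronglyMeasurable.smul hh
    have hIa : Integrable (fun ω => h (X ω)) (μ.restrict A) := by
      change Integrable (h ∘ X) _
      rw [← integrable_map_measure hh' hX.aemeasurable, hd,
        integrable_withDensity_iff_integrable_smul₀' hqm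
          (ae_of_all _ fun _ => ENNReal.ofReal_lt_top), integrable_congr heq,
        integrable_map_measure hqh hX.aemeasurable]
      exact hi
    have hcongr : (fun ω => h (X ω)) =ᵐ[μ.restrict A] fun ω => Q (X ω) (y ω) := by
      filter_upwards [ae_restrict_mem hA] with ω hω
      rw [hyA ω hω, hhQ]
    refine ⟨hIa.congr hcongr, ?_⟩
    rw [← integral_congr_ae hcongr, ← integral_map hX.aemeasurable hh', hd,
      integral_withDensity_eq_integral_toReal_smul₀ hqm
        (ae_of_all _ fun _ => ENNReal.ofReal_lt_top), integral_congr_ae heq,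
      integral_map hX.aemeasurable hqh]
  have hcondc : μ⟦Sᶜ | MeasurableSpace.comap X m𝓧⟧ =ᵐ[μ] fun ω => (fun t => 1 - k t) (X ω) := by
    have h1 : (Sᶜ.indicator fun _ => (1 : ℝ)) = (fun _ => 1) - S.indicator fun _ => (1 : ℝ) := by
      ext ω
      by_cases h : ω ∈ S <;> simp [h]
    rw [h1]
    filter_upwards [condExp_sub (m := MeasurableSpace.comap X m𝓧) (integrable_const (μ := μ) (1 : ℝ))
      ((integrable_const (1 : ℝ)).indicator hS), hcond] with ω h2 h3
    rw [h2, Pi.sub_apply, h3, condExp_const hm]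
  obtain ⟨a1, a2⟩ := part S k _ 1 hS hk (hk01.mono fun _ h => h.1) hcond hQ1 hi1
    (fun ω h => h) rfl
  obtain ⟨b1, b2⟩ := part Sᶜ (fun t => 1 - k t) _ 0 hS.compl (by fun_prop)
    (hk01.mono fun _ h => sub_nonneg.2 h.2) hcondc hQ0 hi0
    (fun ω h => (hy01 ω).resolve_right h) rfl
  have hall : Integrable (fun ω => Q (X ω) (y ω)) μ := by
    rw [← integrableOn_univ, ← Set.union_compl_self S]
    exact a1.union b1
  refine ⟨hall, ?_⟩
  rw [integral_add hi1 hi0, ← a2, ← b2, integral_add_compl hS hall]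

end Unlabeled

/-! ### Sums of i.i.d. terms and asymptotic normality -/

namespace Unlabeled

section Sums

variable {Ω T : Type*} [MeasurableSpace Ω] [MeasurableSpace T] {μ : Measure Ω}
  {W : ℕ → Ω → T}

lemma memLp_sum_range (hident : ∀ i, IdentDistrib (W i) (W 0) μ μ) {u : T → ℝ}
    (hu : Measurable u) (hu2 : MemLp (fun ω => u (W 0 ω)) 2 μ) (m : ℕ) :
    MemLp (fun ω => ∑ i ∈ Finset.range m, u (W i ω)) 2 μ :=
  memLp_finsetSum _ fun i _ => ((hident i).comp hu).memLp_iff.2 hu2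

variable [IsProbabilityMeasure μ]

lemma integral_sq_sum_range (hindep : iIndepFun W μ)
    (hident : ∀ i, IdentDistrib (W i) (W 0) μ μ) {u : T → ℝ}
    (hu : Measurable u) (hu2 : MemLp (fun ω => u (W 0 ω)) 2 μ) (hu0 : ∫ ω, u (W 0 ω) ∂μ = 0)
    (m : ℕ) : ∫ ω, (∑ i ∈ Finset.range m, u (W i ω)) ^ 2 ∂μ =
      m * Var[fun ω => u (W 0 ω); μ] := by
  have hid : ∀ i, IdentDistrib (fun ω => u (W i ω)) (fun ω => u (W 0 ω)) μ μ :=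
    fun i => (hident i).comp hu
  have hL : ∀ i, MemLp (fun ω => u (W i ω)) 2 μ := fun i => (hid i).memLp_iff.2 hu2
  have hmean : ∫ ω, ∑ i ∈ Finset.range m, u (W i ω) ∂μ = 0 := by
    rw [integral_finsetSum _ fun i _ => (hL i).integrable (by norm_num)]
    exact Finset.sum_eq_zero fun i _ => by rw [(hid i).integral_eq, hu0]
  have hv := IndepFun.variance_sum (μ := μ) (X := fun i ω => u (W i ω)) (s := Finset.range m)
    (fun i _ => hL i) (fun i _ k _ hik => (hindep.indepFun hik).comp hu hu)
  rw [Finset.sum_congr rfl fun i _ => (hid i).variance_eq, Finset.sum_const, Finset.card_range,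
    nsmul_eq_mul] at hv
  rw [← hv, variance_eq_integral]
  · simp only [Finset.sum_apply, hmean, sub_zero]
  · have := (memLp_sum_range hident hu hu2 m).aestronglyMeasurable.aemeasurable
    convert this using 1
    ext ω
    simp

/-- Asymptotic normality of an estimator that is, up to a negligible remainder, a sum of two
blocks of independent and identically distributed terms. -/
theorem hasLimitVariance_of_two_blocks (hindep : iIndepFun W μ)
    (hident : ∀ i, IdentDistrib (W i) (W 0) μ μ) {x y z : T → ℝ} (hx : Measurable x)
    (hy : Measurable y) (hz : Measurable z) (hx2 : MemLp (fun ω => x (W 0 ω)) 2 μ)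
    (hy2 : MemLp (fun ω => y (W 0 ω)) 2 μ) (hz2 : MemLp (fun ω => z (W 0 ω)) 2 μ)
    (hx0 : ∫ ω, x (W 0 ω) ∂μ = 0) (hy0 : ∫ ω, y (W 0 ω) ∂μ = 0) (hz0 : ∫ ω, z (W 0 ω) ∂μ = 0)
    {r : ℕ → ℕ} (hr : ∀ n, r n ≤ n) {γ : ℝ} (hγ : 0 < γ)
    (hrγ : Tendsto (fun n : ℕ => (r n : ℝ) / n) atTop (𝓝 γ)) {S : ℕ → Ω → ℝ} {q : ℝ}
    (hS : ∀ n, AEMeasurable (S n) μ)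
    (hrem : TendstoInMeasure μ (fun (n : ℕ) ω => √(n : ℝ) * (S n ω - q - (1 / (n : ℝ)) *
      (∑ i ∈ Finset.range (r n), (x (W i ω) + (n : ℝ) / r n * y (W i ω)) +
        ∑ i ∈ Finset.Ico (r n) n, z (W i ω)))) atTop 0) {s : ℝ}
    (hs : s = γ * Var[fun ω => x (W 0 ω) + γ⁻¹ * y (W 0 ω); μ] +
      (1 - γ) * Var[fun ω => z (W 0 ω); μ]) :
    HasLimitVariance μ S q s := by
  have hγ1 : γ ≤ 1 := le_of_tendsto hrγ <| Eventually.of_forall fun n =>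
    div_le_one_of_le₀ (by exact_mod_cast hr n) (Nat.cast_nonneg n)
  have hs0 : 0 ≤ s := by
    rw [hs]
    exact add_nonneg (mul_nonneg hγ.le (variance_nonneg _ _))
      (mul_nonneg (sub_nonneg.2 hγ1) (variance_nonneg _ _))
  have hγy2 : MemLp (fun ω => γ⁻¹ * y (W 0 ω)) 2 μ := hy2.const_mul _
  have hclt := tendstoInDistribution_two_blocks hindep hident (u := fun w => x w + γ⁻¹ * y w)
    (by fun_prop) hz (hx2.add hγy2) hz2
    (by rw [integral_add (hx2.integrable (by norm_num)) (hγy2.integrable (by norm_num)),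
          integral_const_mul, hx0, hy0]; simp) hz0 hr hrγ hs0 hs
  -- The central limit theorem is applied with the constant coefficient `γ⁻¹`. Replacing it by the
  -- true coefficient `n / r n` costs a term whose second moment is `(n/r - γ⁻¹)² (r/n) Var y`,
  -- which tends to zero.
  have hcor : TendstoInMeasure μ (fun (n : ℕ) ω => ((n : ℝ) / r n - γ⁻¹) * (√(n : ℝ))⁻¹ *
      ∑ i ∈ Finset.range (r n), y (W i ω)) atTop 0 := by
    refine tendstoInMeasure_of_sq_integral_tendsto
      (fun n => (memLp_sum_range hident hy hy2 (r n)).const_mul _) ?_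
    have h1 : Tendsto (fun n : ℕ => ((n : ℝ) / r n - γ⁻¹) ^ 2 *
        (((r n : ℝ) / n) * Var[fun ω => y (W 0 ω); μ])) atTop (𝓝 0) := by
      have h2 : Tendsto (fun n : ℕ => (n : ℝ) / r n) atTop (𝓝 γ⁻¹) :=
        (hrγ.inv₀ hγ.ne').congr fun n => inv_div _ _
      have h3 := ((h2.sub_const γ⁻¹).pow 2).mul
        (hrγ.mul_const (Var[fun ω => y (W 0 ω); μ]))
      simpa using h3
    refine h1.congr fun n => ?_
    simp only [mul_pow]
    rw [integral_const_mul, integral_sq_sum_range hindep hident hy hy2 hy0, inv_pow,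
      Real.sq_sqrt (Nat.cast_nonneg n)]
    ring
  have hcorm : ∀ n : ℕ, AEMeasurable (fun ω => ((n : ℝ) / r n - γ⁻¹) * (√(n : ℝ))⁻¹ *
      ∑ i ∈ Finset.range (r n), y (W i ω)) μ := fun n =>
    (memLp_sum_range hident hy hy2 (r n)).aestronglyMeasurable.aemeasurable.const_mul _
  have hclt' := tendstoInDistribution_of_tendstoInMeasure_sub _ _ hclt
    (hcor.congr_left fun n => ae_of_all _ fun ω => (add_sub_cancel_left _ _).symm)
    fun n => (hclt.forall_aemeasurable n).add (hcorm n)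
  refine ⟨hs0, tendstoInDistribution_of_tendstoInMeasure_sub _ _ hclt' ?_
    fun n => ((hS n).sub_const q).const_mul _⟩
  refine hrem.congr_left fun n => ae_of_all _ fun ω => ?_
  simp only [Pi.sub_apply]
  have hsq : √(n : ℝ) * (1 / (n : ℝ)) = (√(n : ℝ))⁻¹ := by
    rw [mul_one_div, Real.sqrt_div_self']
    exact one_div _
  simp only [Finset.sum_add_distrib, ← Finset.mul_sum]
  rw [mul_sub, ← mul_assoc, hsq]
  ring

end Sums

end Unlabeled

/-! ### Calculus of the score and the exceptional null set -/

namespace Unlabeled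

section Calculus

variable {f p : ℕ} {g : (Fin f → ℝ) → EuclideanSpace ℝ (Fin p) → ℝ}
  {U : Set (EuclideanSpace ℝ (Fin p))} {t : Fin f → ℝ}

lemma inner_gradient_eq_fderiv (h : EuclideanSpace ℝ (Fin p) → ℝ)
    (ϑ v : EuclideanSpace ℝ (Fin p)) : inner ℝ (gradient h ϑ) v = fderiv ℝ h ϑ v := by
  rw [gradient, InnerProductSpace.toDual_symm_apply]

lemma norm_fderiv_eq_norm_gradient (h : EuclideanSpace ℝ (Fin p) → ℝ)
    (ϑ : EuclideanSpace ℝ (Fin p)) : ‖fderiv ℝ h ϑ‖ = ‖gradient h ϑ‖ := by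
  rw [gradient, LinearIsometryEquiv.norm_map]

lemma contDiffOn_gradient (hU : IsOpen U) (ht : ContDiffOn ℝ 2 (g t) U) :
    ContDiffOn ℝ 1 (gradient (g t)) U := by
  have h1 : ContDiffOn ℝ 1 (fderiv ℝ (g t)) U := ht.fderiv_of_isOpen hU (by norm_num)
  exact (InnerProductSpace.toDual ℝ (EuclideanSpace ℝ (Fin p))).symm.contDiff.comp_contDiffOn h1

lemma contDiffOn_weight_smul_gradient (hU : IsOpen U) (ht : ContDiffOn ℝ 2 (g t) U)
    (h01 : ∀ ϑ ∈ U, g t ϑ ∈ Set.Ioo (0 : ℝ) 1) :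
    ContDiffOn ℝ 1 (fun ϑ => weight g t ϑ • gradient (g t) ϑ) U := by
  have hg : ContDiffOn ℝ 1 (g t) U := ht.of_le (by norm_num)
  have hw : ContDiffOn ℝ 1 (weight g t) U :=
    contDiffOn_const.div (hg.mul (contDiffOn_const.sub hg)) fun ϑ hϑ =>
      mul_ne_zero (h01 ϑ hϑ).1.ne' (sub_pos.2 (h01 ϑ hϑ).2).ne'
  exact hw.smul (contDiffOn_gradient hU ht)

lemma score_eq_smul (y : ℝ) (ϑ : EuclideanSpace ℝ (Fin p)) :
    score g t y ϑ = (y - g t ϑ) • (weight g t ϑ • gradient (g t) ϑ) := by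
  rw [score, smul_smul, mul_comm]

lemma contDiffOn_score (hU : IsOpen U) (ht : ContDiffOn ℝ 2 (g t) U)
    (h01 : ∀ ϑ ∈ U, g t ϑ ∈ Set.Ioo (0 : ℝ) 1) (y : ℝ) : ContDiffOn ℝ 1 (score g t y) U := by
  have hg : ContDiffOn ℝ 1 (g t) U := ht.of_le (by norm_num)
  have h := (contDiffOn_const (c := y)).sub hg |>.smul (contDiffOn_weight_smul_gradient hU ht h01)
  exact h.congr fun ϑ _ => score_eq_smul y ϑ

/-- Keeping `y - g` as an outer factor isolates a first term that vanishes in conditional mean given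
the feature, whatever the derivative of `w g'` is. Only `-w g' g'ᵀ` survives, with mean `-A`. -/
lemma fderiv_score (hU : IsOpen U) (ht : ContDiffOn ℝ 2 (g t) U)
    (h01 : ∀ ϑ ∈ U, g t ϑ ∈ Set.Ioo (0 : ℝ) 1) (y : ℝ) {ϑ : EuclideanSpace ℝ (Fin p)}
    (hϑ : ϑ ∈ U) : fderiv ℝ (score g t y) ϑ =
      (y - g t ϑ) • fderiv ℝ (fun ϑ => weight g t ϑ • gradient (g t) ϑ) ϑ -
        (fderiv ℝ (g t) ϑ).smulRight (weight g t ϑ • gradient (g t) ϑ) := by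
  have hg : DifferentiableAt ℝ (g t) ϑ :=
    (ht.contDiffAt (hU.mem_nhds hϑ)).differentiableAt (by norm_num)
  have hk : DifferentiableAt ℝ (fun ϑ => weight g t ϑ • gradient (g t) ϑ) ϑ :=
    ((contDiffOn_weight_smul_gradient hU ht h01).contDiffAt
      (hU.mem_nhds hϑ)).differentiableAt (by norm_num)
  have h := (hg.hasFDerivAt.const_sub y).smul hk.hasFDerivAt
  rw [show score g t y = fun ϑ => (y - g t ϑ) • (weight g t ϑ • gradient (g t) ϑ) from
    funext fun ϑ => score_eq_smul y ϑ]
  refine h.fderiv.trans ?_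
  ext v
  simp [sub_eq_add_neg]

end Calculus

/-- A measurable set of features that contains `X 0` almost surely and on which the smoothness and
the bounds of the regularity conditions hold without exception. -/
structure IsGoodSet {Ω : Type*} [MeasurableSpace Ω] (μ : Measure Ω) {f p : ℕ}
    (X : ℕ → Ω → Fin f → ℝ) (g : (Fin f → ℝ) → EuclideanSpace ℝ (Fin p) → ℝ)
    (U K : Set (EuclideanSpace ℝ (Fin p))) (G : Set (Fin f → ℝ)) (H : (Fin f → ℝ) → ℝ) :
    Prop where
  measurableSet : MeasurableSet G
  ae_mem : ∀ᵐ ω ∂μ, X 0 ω ∈ G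
  integrable : Integrable (fun ω => H (X 0 ω)) μ
  mem_Ioo : ∀ t ∈ G, ∀ ϑ ∈ U, g t ϑ ∈ Set.Ioo (0 : ℝ) 1
  contDiffOn : ∀ t ∈ G, ContDiffOn ℝ 2 (g t) U
  norm_gradient_le : ∀ t ∈ G, ∀ ϑ ∈ K, ‖gradient (g t) ϑ‖ ≤ H t
  norm_score_le : ∀ t ∈ G, ∀ ϑ ∈ K, ∀ y : ℝ, y = 0 ∨ y = 1 → ‖score g t y ϑ‖ ≤ H t
  norm_fderiv_score_le : ∀ t ∈ G, ∀ ϑ ∈ K, ∀ y : ℝ, y = 0 ∨ y = 1 →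
    ‖fderiv ℝ (score g t y) ϑ‖ ≤ H t

section GoodSet

variable {Ω : Type*} [MeasurableSpace Ω] {μ : Measure Ω} {f c p : ℕ}
  {X : ℕ → Ω → Fin f → ℝ} {Y : ℕ → Ω → Fin c → ℝ} {j : Fin c}
  {g : (Fin f → ℝ) → EuclideanSpace ℝ (Fin p) → ℝ} {θ : EuclideanSpace ℝ (Fin p)}
  {U K : Set (EuclideanSpace ℝ (Fin p))} {G : Set (Fin f → ℝ)} {H : (Fin f → ℝ) → ℝ}

/-- A set of full measure contains a measurable one. Passing to it once replaces the
almost-everywhere conditions by pointwise ones. -/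
lemma IsRegular.exists_isGoodSet (hreg : IsRegular μ X Y j g θ U K) (hX : Measurable (X 0)) :
    ∃ G H, IsGoodSet μ X g U K G H := by
  obtain ⟨H, hHi, hH⟩ := hreg.envelope
  obtain ⟨G, hG, hGm, hGp⟩ :=
    ((hreg.mem_Ioo.and hreg.contDiffOn).and hH).exists_measurable_mem
  exact ⟨G, H, hGm, ae_of_ae_map hX.aemeasurable hG, hHi.comp_measurable hX,
    fun t ht => (hGp t ht).1.1, fun t ht => (hGp t ht).1.2,
    fun t ht ϑ hϑ => ((hGp t ht).2 ϑ hϑ).1, fun t ht ϑ hϑ y hy => (((hGp t ht).2 ϑ hϑ).2 y hy).1,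
    fun t ht ϑ hϑ y hy => (((hGp t ht).2 ϑ hϑ).2 y hy).2⟩

lemma IsGoodSet.measurable_indicator_fderiv (hG : IsGoodSet μ X g U K G H) (hU : IsOpen U)
    (hg : Measurable (Function.uncurry g)) {ϑ : EuclideanSpace ℝ (Fin p)} (hϑ : ϑ ∈ U) :
    Measurable (G.indicator fun t => fderiv ℝ (g t) ϑ) :=
  Unlabeled.measurable_indicator_fderiv hU
    (fun ϑ' _ => (hg.comp (by fun_prop : Measurable fun t : Fin f → ℝ => (t, ϑ'))).indicator
      hG.measurableSet) hϑ
    fun t ht => ((hG.contDiffOn t ht).contDiffAt (hU.mem_nhds hϑ)).differentiableAt (by norm_num)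

lemma IsGoodSet.measurable_indicator_gradient (hG : IsGoodSet μ X g U K G H) (hU : IsOpen U)
    (hg : Measurable (Function.uncurry g)) {ϑ : EuclideanSpace ℝ (Fin p)} (hϑ : ϑ ∈ U) :
    Measurable (G.indicator fun t => gradient (g t) ϑ) := by
  convert (InnerProductSpace.toDual ℝ (EuclideanSpace ℝ (Fin p))).symm.continuous.measurable.comp
    (hG.measurable_indicator_fderiv hU hg hϑ) using 1
  ext1 t
  by_cases ht : t ∈ G
  · simp [ht, gradient]
  · simp [ht]

lemma measurable_weight (hg : Measurable (Function.uncurry g))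
    (ϑ : EuclideanSpace ℝ (Fin p)) : Measurable fun t => weight g t ϑ := by
  have h : Measurable fun t => g t ϑ :=
    hg.comp (by fun_prop : Measurable fun t : Fin f → ℝ => (t, ϑ))
  exact (measurable_const.div (h.mul (measurable_const.sub h)))

/-- The set of good features, together with a class indicator. -/
def labeledSet (G : Set (Fin f → ℝ)) : Set ((Fin f → ℝ) × ℝ) := G ×ˢ {0, 1}

lemma IsGoodSet.measurableSet_labeledSet (hG : IsGoodSet μ X g U K G H) :
    MeasurableSet (labeledSet G) :=
  hG.measurableSet.prod ((measurableSet_singleton (1 : ℝ)).insert 0)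

lemma IsGoodSet.measurable_indicator_score (hG : IsGoodSet μ X g U K G H) (hU : IsOpen U)
    (hg : Measurable (Function.uncurry g)) {ϑ : EuclideanSpace ℝ (Fin p)} (hϑ : ϑ ∈ U) :
    Measurable ((labeledSet G).indicator fun w : (Fin f → ℝ) × ℝ => score g w.1 w.2 ϑ) := by
  have h1 : Measurable fun w : (Fin f → ℝ) × ℝ => (weight g w.1 ϑ * (w.2 - g w.1 ϑ)) •
      G.indicator (fun t => gradient (g t) ϑ) w.1 := by
    have hgϑ : Measurable fun w : (Fin f → ℝ) × ℝ => g w.1 ϑ :=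
      hg.comp (by fun_prop : Measurable fun w : (Fin f → ℝ) × ℝ => (w.1, ϑ))
    exact (((measurable_weight hg ϑ).comp measurable_fst).mul (measurable_snd.sub hgϑ)).smul
      ((hG.measurable_indicator_gradient hU hg hϑ).comp measurable_fst)
  convert h1.indicator hG.measurableSet_labeledSet using 1
  ext1 w
  by_cases hw : w ∈ labeledSet G
  · rw [Set.indicator_of_mem hw, Set.indicator_of_mem hw, Set.indicator_of_mem hw.1]
    rfl
  · rw [Set.indicator_of_notMem hw, Set.indicator_of_notMem hw]

lemma IsGoodSet.measurable_indicator_fderiv_score (hG : IsGoodSet μ X g U K G H) (hU : IsOpen U)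
    (hg : Measurable (Function.uncurry g)) {ϑ : EuclideanSpace ℝ (Fin p)} (hϑ : ϑ ∈ U) :
    Measurable ((labeledSet G).indicator
      fun w : (Fin f → ℝ) × ℝ => fderiv ℝ (score g w.1 w.2) ϑ) :=
  Unlabeled.measurable_indicator_fderiv hU
    (fun _ hϑ' => hG.measurable_indicator_score hU hg hϑ') hϑ
    fun w hw => ((contDiffOn_score hU (hG.contDiffOn w.1 hw.1) (hG.mem_Ioo w.1 hw.1)
      w.2).contDiffAt (hU.mem_nhds hϑ)).differentiableAt (by norm_num)

end GoodSet

end Unlabeled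

/-! ### The matrix A and the vector B as expectations -/

namespace Unlabeled

section Moments

variable {Ω : Type*} [MeasurableSpace Ω] {μ : Measure Ω} {f c p : ℕ}
  {X : ℕ → Ω → Fin f → ℝ} {Y : ℕ → Ω → Fin c → ℝ} {j : Fin c}
  {g : (Fin f → ℝ) → EuclideanSpace ℝ (Fin p) → ℝ} {θ : EuclideanSpace ℝ (Fin p)}
  {U K : Set (EuclideanSpace ℝ (Fin p))} {G : Set (Fin f → ℝ)} {H : (Fin f → ℝ) → ℝ}

/-- The gradient at `θ`, set to zero at exceptional features. -/
noncomputable def gradAt (g : (Fin f → ℝ) → EuclideanSpace ℝ (Fin p) → ℝ)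
    (θ : EuclideanSpace ℝ (Fin p)) (G : Set (Fin f → ℝ)) : (Fin f → ℝ) → EuclideanSpace ℝ (Fin p) :=
  G.indicator fun t => gradient (g t) θ

/-- The score at `θ`, set to zero at exceptional features. -/
noncomputable def scoreAt (g : (Fin f → ℝ) → EuclideanSpace ℝ (Fin p) → ℝ)
    (θ : EuclideanSpace ℝ (Fin p)) (G : Set (Fin f → ℝ)) (w : (Fin f → ℝ) × ℝ) :
    EuclideanSpace ℝ (Fin p) :=
  (weight g w.1 θ * (w.2 - g w.1 θ)) • gradAt g θ G w.1

lemma gradAt_of_mem {t : Fin f → ℝ} (ht : t ∈ G) : gradAt g θ G t = gradient (g t) θ :=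
  Set.indicator_of_mem ht _

lemma scoreAt_of_mem {t : Fin f → ℝ} (ht : t ∈ G) (y : ℝ) :
    scoreAt g θ G (t, y) = score g t y θ := by
  rw [scoreAt, gradAt_of_mem ht, score]

lemma IsRegular.theta_mem (hreg : IsRegular μ X Y j g θ U K) : θ ∈ K :=
  interior_subset hreg.mem_interior

lemma IsRegular.theta_mem_U (hreg : IsRegular μ X Y j g θ U K) : θ ∈ U :=
  hreg.subset hreg.theta_mem

lemma IsRegular.measurable_apply (hreg : IsRegular μ X Y j g θ U K) :
    Measurable fun t => g t θ :=
  hreg.measurable.comp (by fun_prop : Measurable fun t : Fin f → ℝ => (t, θ))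

lemma IsGoodSet.measurable_gradAt (hG : IsGoodSet μ X g U K G H)
    (hreg : IsRegular μ X Y j g θ U K) : Measurable (gradAt g θ G) :=
  hG.measurable_indicator_gradient hreg.isOpen hreg.measurable hreg.theta_mem_U

lemma IsGoodSet.measurable_scoreAt (hG : IsGoodSet μ X g U K G H)
    (hreg : IsRegular μ X Y j g θ U K) : Measurable (scoreAt g θ G) :=
  (((measurable_weight hreg.measurable θ).comp measurable_fst).mul
    (measurable_snd.sub (hreg.measurable_apply.comp measurable_fst))).smul
    ((hG.measurable_gradAt hreg).comp measurable_fst)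

lemma IsGoodSet.weight_pos (hG : IsGoodSet μ X g U K G H) {t : Fin f → ℝ} (ht : t ∈ G)
    {ϑ : EuclideanSpace ℝ (Fin p)} (hϑ : ϑ ∈ U) : 0 < weight g t ϑ :=
  one_div_pos.2 (mul_pos (hG.mem_Ioo t ht ϑ hϑ).1 (sub_pos.2 (hG.mem_Ioo t ht ϑ hϑ).2))

lemma IsGoodSet.weight_mul (hG : IsGoodSet μ X g U K G H) {t : Fin f → ℝ} (ht : t ∈ G)
    {ϑ : EuclideanSpace ℝ (Fin p)} (hϑ : ϑ ∈ U) : weight g t ϑ * (g t ϑ * (1 - g t ϑ)) = 1 :=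
  one_div_mul_cancel (mul_pos (hG.mem_Ioo t ht ϑ hϑ).1 (sub_pos.2 (hG.mem_Ioo t ht ϑ hϑ).2)).ne'

lemma IsGoodSet.norm_gradAt_le (hG : IsGoodSet μ X g U K G H)
    (hreg : IsRegular μ X Y j g θ U K) {t : Fin f → ℝ} (ht : t ∈ G) :
    ‖gradAt g θ G t‖ ≤ H t := by
  rw [gradAt_of_mem ht]
  exact hG.norm_gradient_le t ht θ hreg.theta_mem

lemma IsGoodSet.integrable_gradAt (hG : IsGoodSet μ X g U K G H)
    (hreg : IsRegular μ X Y j g θ U K) (hX : Measurable (X 0)) :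
    Integrable (fun ω => gradAt g θ G (X 0 ω)) μ :=
  hG.integrable.mono' ((hG.measurable_gradAt hreg).comp hX).aestronglyMeasurable
    (hG.ae_mem.mono fun _ hω => hG.norm_gradAt_le hreg hω)

/-- By Cauchy–Schwarz the norm is at most `‖v‖ w ‖g'‖²`. -/
lemma IsGoodSet.integrable_weight_mul_inner_smul (hG : IsGoodSet μ X g U K G H)
    (hreg : IsRegular μ X Y j g θ U K) (hX : Measurable (X 0)) (v : EuclideanSpace ℝ (Fin p)) :
    Integrable (fun ω => (weight g (X 0 ω) θ * inner ℝ (gradAt g θ G (X 0 ω)) v) •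
      gradAt g θ G (X 0 ω)) μ := by
  refine (hreg.integrable_A.const_mul ‖v‖).mono' ?_ ?_
  · have hm := hG.measurable_gradAt hreg
    exact ((((measurable_weight hreg.measurable θ).mul (hm.inner measurable_const)).smul
      hm).comp hX).aestronglyMeasurable
  · filter_upwards [hG.ae_mem] with ω hω
    have hw := hG.weight_pos hω hreg.theta_mem_U
    rw [gradAt_of_mem hω, norm_smul, norm_mul, Real.norm_of_nonneg hw.le]
    have h := norm_inner_le_norm (𝕜 := ℝ) (gradient (g (X 0 ω)) θ) v
    calc _ ≤ weight g (X 0 ω) θ * (‖gradient (g (X 0 ω)) θ‖ * ‖v‖) *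
          ‖gradient (g (X 0 ω)) θ‖ := by gcongr
      _ = _ := by ring

lemma IsGoodSet.integrable_weight_mul_inner_mul_inner (hG : IsGoodSet μ X g U K G H)
    (hreg : IsRegular μ X Y j g θ U K) (hX : Measurable (X 0)) (v u : EuclideanSpace ℝ (Fin p)) :
    Integrable (fun ω => weight g (X 0 ω) θ * inner ℝ (gradAt g θ G (X 0 ω)) v *
      inner ℝ (gradAt g θ G (X 0 ω)) u) μ := by
  have h := (hG.integrable_weight_mul_inner_smul hreg hX v).inner_const (𝕜 := ℝ) u
  simpa only [real_inner_smul_left] using h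

/-- The matrix `A` acts by `v ↦ E[w ⟪g', v⟫ g']`. -/
lemma IsGoodSet.matA_mulVec (hG : IsGoodSet μ X g U K G H)
    (hreg : IsRegular μ X Y j g θ U K) (hX : Measurable (X 0)) (v : EuclideanSpace ℝ (Fin p)) :
    (matA μ X g θ).mulVec v.ofLp = (∫ ω, (weight g (X 0 ω) θ *
      inner ℝ (gradAt g θ G (X 0 ω)) v) • gradAt g θ G (X 0 ω) ∂μ).ofLp := by
  ext k
  have h1 : (∫ ω, (weight g (X 0 ω) θ * inner ℝ (gradAt g θ G (X 0 ω)) v) •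
      gradAt g θ G (X 0 ω) ∂μ).ofLp k = ∫ ω, (weight g (X 0 ω) θ *
      inner ℝ (gradAt g θ G (X 0 ω)) v) * gradAt g θ G (X 0 ω) k ∂μ :=
    ((EuclideanSpace.proj (𝕜 := ℝ) k).integral_comp_comm
      (hG.integrable_weight_mul_inner_smul hreg hX v)).symm
  have h2 : ∀ l, Integrable (fun ω => weight g (X 0 ω) θ * gradient (g (X 0 ω)) θ k *
      gradient (g (X 0 ω)) θ l) μ := by
    intro l
    refine (hG.integrable_weight_mul_inner_mul_inner hreg hX (EuclideanSpace.single k 1)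
      (EuclideanSpace.single l 1)).congr ?_
    filter_upwards [hG.ae_mem] with ω hω
    simp only [gradAt_of_mem hω, EuclideanSpace.inner_single_right, conj_trivial, one_mul]
  rw [h1]
  simp only [Matrix.mulVec, dotProduct, matA, Matrix.of_apply]
  simp_rw [← integral_mul_const]
  rw [← integral_finsetSum _ fun l _ => (h2 l).mul_const _]
  refine integral_congr_ae ?_
  filter_upwards [hG.ae_mem] with ω hω
  simp only [gradAt_of_mem hω, PiLp.inner_apply, RCLike.inner_apply, conj_trivial, Finset.mul_sum,
    Finset.sum_mul]
  exact Finset.sum_congr rfl fun l _ => by ring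

lemma IsGoodSet.vecB_eq (hG : IsGoodSet μ X g U K G H)
    (hreg : IsRegular μ X Y j g θ U K) (hX : Measurable (X 0)) :
    vecB μ X g θ = (∫ ω, gradAt g θ G (X 0 ω) ∂μ).ofLp := by
  ext k
  have h1 : (∫ ω, gradAt g θ G (X 0 ω) ∂μ).ofLp k = ∫ ω, gradAt g θ G (X 0 ω) k ∂μ :=
    ((EuclideanSpace.proj (𝕜 := ℝ) k).integral_comp_comm
      (hG.integrable_gradAt hreg hX)).symm
  rw [h1, vecB]
  refine integral_congr_ae ?_
  filter_upwards [hG.ae_mem] with ω hω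
  rw [gradAt_of_mem hω]

/-- Injectivity of `A` without coordinates; it makes the mean derivative of the score injective. -/
lemma IsGoodSet.eq_zero_of_integral_eq_zero (hG : IsGoodSet μ X g U K G H)
    (hreg : IsRegular μ X Y j g θ U K) (hX : Measurable (X 0)) {v : EuclideanSpace ℝ (Fin p)}
    (hv : ∫ ω, (weight g (X 0 ω) θ * inner ℝ (gradAt g θ G (X 0 ω)) v) •
      gradAt g θ G (X 0 ω) ∂μ = 0) : v = 0 := by
  have h1 := hG.matA_mulVec hreg hX v
  rw [hv] at h1
  have h2 := Matrix.mulVec_injective_of_isUnit hreg.isUnit_A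
    (h1.trans (Matrix.mulVec_zero _).symm)
  exact (WithLp.ofLp_injective 2) h2

/-- The vector `A⁻¹ B` and the quadratic form `Bᵀ A⁻¹ B` in terms of expectations. -/
lemma IsGoodSet.exists_direction (hG : IsGoodSet μ X g U K G H)
    (hreg : IsRegular μ X Y j g θ U K) (hX : Measurable (X 0)) :
    ∃ b : EuclideanSpace ℝ (Fin p),
      (∀ v, ∫ ω, inner ℝ (gradAt g θ G (X 0 ω)) v ∂μ = ∫ ω, weight g (X 0 ω) θ *
        inner ℝ (gradAt g θ G (X 0 ω)) v * inner ℝ (gradAt g θ G (X 0 ω)) b ∂μ) ∧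
      vecB μ X g θ ⬝ᵥ (matA μ X g θ)⁻¹.mulVec (vecB μ X g θ) =
        ∫ ω, inner ℝ (gradAt g θ G (X 0 ω)) b ∂μ := by
  -- With `b = A⁻¹B` the two claims read `⟪B, v⟫ = vᵀAb` and `BᵀA⁻¹B = ⟪B, b⟫`.
  set b : EuclideanSpace ℝ (Fin p) :=
    WithLp.toLp 2 ((matA μ X g θ)⁻¹.mulVec (vecB μ X g θ)) with hb
  have hinner : ∀ v : EuclideanSpace ℝ (Fin p), ∫ ω, inner ℝ (gradAt g θ G (X 0 ω)) v ∂μ =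
      inner ℝ (∫ ω, gradAt g θ G (X 0 ω) ∂μ) v := by
    intro v
    simp_rw [real_inner_comm v]
    exact integral_inner (hG.integrable_gradAt hreg hX) v
  have hAb : ∫ ω, (weight g (X 0 ω) θ * inner ℝ (gradAt g θ G (X 0 ω)) b) •
      gradAt g θ G (X 0 ω) ∂μ = ∫ ω, gradAt g θ G (X 0 ω) ∂μ := by
    apply WithLp.ofLp_injective 2
    rw [← hG.matA_mulVec hreg hX b, ← hG.vecB_eq hreg hX, hb]
    simp only [Matrix.mulVec_mulVec]
    rw [Matrix.mul_nonsing_inv _ ((Matrix.isUnit_iff_isUnit_det _).1 hreg.isUnit_A),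
      Matrix.one_mulVec]
  refine ⟨b, fun v => ?_, ?_⟩
  · rw [hinner v, ← hAb, real_inner_comm,
      ← integral_inner (hG.integrable_weight_mul_inner_smul hreg hX b)]
    refine integral_congr_ae (ae_of_all _ fun ω => ?_)
    simp only [real_inner_smul_right, real_inner_comm v]
    ring
  · rw [hinner b, hG.vecB_eq hreg hX, hb, dotProduct, PiLp.inner_apply]
    simp only [RCLike.inner_apply, conj_trivial, hG.vecB_eq hreg hX]
    exact Finset.sum_congr rfl fun l _ => mul_comm _ _

end Moments

end Unlabeled

/-! ### Conditional moments of the score and the variance inequality -/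

namespace Unlabeled

section Conditioning

variable {Ω : Type*} [MeasurableSpace Ω] {μ : Measure Ω} {f c p : ℕ}
  {X : ℕ → Ω → Fin f → ℝ} {Y : ℕ → Ω → Fin c → ℝ} {j : Fin c}
  {g : (Fin f → ℝ) → EuclideanSpace ℝ (Fin p) → ℝ} {θ : EuclideanSpace ℝ (Fin p)}
  {U K : Set (EuclideanSpace ℝ (Fin p))} {G : Set (Fin f → ℝ)} {H : (Fin f → ℝ) → ℝ}

lemma IsSample.measurable_Y_apply (hsample : IsSample μ X Y) (j : Fin c) :
    Measurable fun ω => Y 0 ω j :=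
  (measurable_pi_apply j).comp (hsample.measurable_Y 0)

variable [IsProbabilityMeasure μ]

lemma IsGoodSet.integral_cond (hG : IsGoodSet μ X g U K G H) (hreg : IsRegular μ X Y j g θ U K)
    (hsample : IsSample μ X Y)
    (hmodel : μ⟦{ω | Y 0 ω j = 1} | MeasurableSpace.comap (X 0) inferInstance⟧
      =ᵐ[μ] fun ω => g (X 0 ω) θ) {E : Type*} [NormedAddCommGroup E] [NormedSpace ℝ E]
    {Q : (Fin f → ℝ) → ℝ → E}
    (hQ1 : AEStronglyMeasurable (fun t => Q t 1) (μ.map (X 0)))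
    (hQ0 : AEStronglyMeasurable (fun t => Q t 0) (μ.map (X 0)))
    (hi1 : Integrable (fun ω => g (X 0 ω) θ • Q (X 0 ω) 1) μ)
    (hi0 : Integrable (fun ω => (1 - g (X 0 ω) θ) • Q (X 0 ω) 0) μ) :
    Integrable (fun ω => Q (X 0 ω) (Y 0 ω j)) μ ∧ ∫ ω, Q (X 0 ω) (Y 0 ω j) ∂μ =
      ∫ ω, (g (X 0 ω) θ • Q (X 0 ω) 1 + (1 - g (X 0 ω) θ) • Q (X 0 ω) 0) ∂μ :=
  integral_indicator_cond (hsample.measurable_X 0) (hsample.measurable_Y_apply j)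
    (fun ω => hsample.zero_or_one 0 ω j) (k := fun t => g t θ) hreg.measurable_apply
    (hG.ae_mem.mono fun _ hω => Set.Ioo_subset_Icc_self (hG.mem_Ioo _ hω _ hreg.theta_mem_U))
    hmodel hQ1 hQ0 hi1 hi0

lemma IsGoodSet.memLp_apply (hG : IsGoodSet μ X g U K G H) (hreg : IsRegular μ X Y j g θ U K)
    (hX : Measurable (X 0)) (s : ENNReal) : MemLp (fun ω => g (X 0 ω) θ) s μ := by
  refine MemLp.of_bound (hreg.measurable_apply.comp hX).aestronglyMeasurable 1 ?_
  filter_upwards [hG.ae_mem] with ω hω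
  have h := hG.mem_Ioo _ hω _ hreg.theta_mem_U
  rw [Real.norm_of_nonneg h.1.le]
  exact h.2.le

lemma IsGoodSet.integrable_apply (hG : IsGoodSet μ X g U K G H)
    (hreg : IsRegular μ X Y j g θ U K) (hX : Measurable (X 0)) :
    Integrable (fun ω => g (X 0 ω) θ) μ :=
  (hG.memLp_apply hreg hX 1).integrable le_rfl

lemma IsGoodSet.integral_apply_eq (hG : IsGoodSet μ X g U K G H)
    (hreg : IsRegular μ X Y j g θ U K) (hsample : IsSample μ X Y)
    (hmodel : μ⟦{ω | Y 0 ω j = 1} | MeasurableSpace.comap (X 0) inferInstance⟧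
      =ᵐ[μ] fun ω => g (X 0 ω) θ) : ∫ ω, Y 0 ω j ∂μ = ∫ ω, g (X 0 ω) θ ∂μ := by
  have h := (hG.integral_cond hreg hsample hmodel (Q := fun _ y => y)
    aestronglyMeasurable_const aestronglyMeasurable_const
    (by simpa using hG.integrable_apply hreg (hsample.measurable_X 0)) (by simp)).2
  simpa using h

/-- The score is centred, conditionally on the feature. -/
lemma IsGoodSet.integral_mul_inner_score (hG : IsGoodSet μ X g U K G H)
    (hreg : IsRegular μ X Y j g θ U K) (hsample : IsSample μ X Y)
    (hmodel : μ⟦{ω | Y 0 ω j = 1} | MeasurableSpace.comap (X 0) inferInstance⟧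
      =ᵐ[μ] fun ω => g (X 0 ω) θ) {h : (Fin f → ℝ) → ℝ} (hh : Measurable h) {C : ℝ}
    (hC : ∀ t ∈ G, |h t| ≤ C) (b : EuclideanSpace ℝ (Fin p)) :
    ∫ ω, h (X 0 ω) * inner ℝ (scoreAt g θ G (X 0 ω, Y 0 ω j)) b ∂μ = 0 := by
  have hX := hsample.measurable_X 0
  have hθ := hreg.theta_mem_U
  have hm := hG.measurable_scoreAt hreg
  -- Since `w g (1-g) = 1`, the labels `1` and `0`, weighted by their conditional probabilities,
  -- contribute opposite amounts.
  have key : ∀ t ∈ G, g t θ * (h t * inner ℝ (scoreAt g θ G (t, 1)) b) =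
      h t * inner ℝ (gradAt g θ G t) b ∧ (1 - g t θ) * (h t * inner ℝ (scoreAt g θ G (t, 0)) b) =
      -(h t * inner ℝ (gradAt g θ G t) b) := by
    intro t ht
    have hw := hG.weight_mul ht hθ
    simp only [scoreAt, real_inner_smul_left]
    constructor
    · linear_combination (h t * inner ℝ (gradAt g θ G t) b) * hw
    · linear_combination (-(h t * inner ℝ (gradAt g θ G t) b)) * hw
  have hint : Integrable (fun ω => h (X 0 ω) * inner ℝ (gradAt g θ G (X 0 ω)) b) μ := by
    refine ((hG.integrable_gradAt hreg hX).inner_const (𝕜 := ℝ) b).bdd_mul (c := C)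
      (hh.comp hX).aestronglyMeasurable ?_
    exact hG.ae_mem.mono fun ω hω => hC _ hω
  have hcond := (hG.integral_cond hreg hsample hmodel
    (Q := fun t y => h t * inner ℝ (scoreAt g θ G (t, y)) b)
    (hh.mul ((hm.comp (by fun_prop : Measurable fun t : Fin f → ℝ => (t, (1 : ℝ)))).inner
      measurable_const)).aestronglyMeasurable
    (hh.mul ((hm.comp (by fun_prop : Measurable fun t : Fin f → ℝ => (t, (0 : ℝ)))).inner
      measurable_const)).aestronglyMeasurable
    (hint.congr (hG.ae_mem.mono fun ω hω => ((key _ hω).1).symm))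
    (hint.neg.congr (hG.ae_mem.mono fun ω hω => ((key _ hω).2).symm))).2
  rw [hcond]
  refine integral_eq_zero_of_ae (hG.ae_mem.mono fun ω hω => ?_)
  simp only [smul_eq_mul, Pi.zero_apply]
  rw [(key _ hω).1, (key _ hω).2, add_neg_cancel]

/-- Second moments of the score. -/
lemma IsGoodSet.memLp_inner_score (hG : IsGoodSet μ X g U K G H)
    (hreg : IsRegular μ X Y j g θ U K) (hsample : IsSample μ X Y)
    (hmodel : μ⟦{ω | Y 0 ω j = 1} | MeasurableSpace.comap (X 0) inferInstance⟧
      =ᵐ[μ] fun ω => g (X 0 ω) θ) (b : EuclideanSpace ℝ (Fin p)) :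
    MemLp (fun ω => inner ℝ (scoreAt g θ G (X 0 ω, Y 0 ω j)) b) 2 μ ∧
    ∫ ω, inner ℝ (scoreAt g θ G (X 0 ω, Y 0 ω j)) b ^ 2 ∂μ = ∫ ω, weight g (X 0 ω) θ *
      inner ℝ (gradAt g θ G (X 0 ω)) b * inner ℝ (gradAt g θ G (X 0 ω)) b ∂μ := by
  have hX := hsample.measurable_X 0
  have hθ := hreg.theta_mem_U
  have hm := hG.measurable_scoreAt hreg
  set V : (Fin f → ℝ) → ℝ := fun t => weight g t θ * inner ℝ (gradAt g θ G t) b *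
    inner ℝ (gradAt g θ G t) b with hV
  have hVi : Integrable (fun ω => V (X 0 ω)) μ :=
    hG.integrable_weight_mul_inner_mul_inner hreg hX b b
  -- The two labels contribute `(1-g) V` and `g V`, which add up to `V`: the conditional variance
  -- `g(1-g)` of the label cancels one factor `w`.
  have key : ∀ t ∈ G, g t θ * inner ℝ (scoreAt g θ G (t, 1)) b ^ 2 = (1 - g t θ) * V t ∧
      (1 - g t θ) * inner ℝ (scoreAt g θ G (t, 0)) b ^ 2 = g t θ * V t := by
    intro t ht
    have hw := hG.weight_mul ht hθ
    simp only [scoreAt, real_inner_smul_left, hV]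
    constructor
    · linear_combination ((1 - g t θ) * weight g t θ * inner ℝ (gradAt g θ G t) b ^ 2) * hw
    · linear_combination (g t θ * weight g t θ * inner ℝ (gradAt g θ G t) b ^ 2) * hw
  have hgm := hreg.measurable_apply
  have hgV : Integrable (fun ω => g (X 0 ω) θ * V (X 0 ω)) μ :=
    hVi.bdd_mul (c := 1) (hgm.comp hX).aestronglyMeasurable
      (hG.ae_mem.mono fun ω hω => by
        have h := hG.mem_Ioo _ hω _ hθ
        rw [Real.norm_of_nonneg h.1.le]
        exact h.2.le)
  have hgV' : Integrable (fun ω => (1 - g (X 0 ω) θ) * V (X 0 ω)) μ :=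
    (hVi.sub hgV).congr (ae_of_all _ fun ω => by simp only [Pi.sub_apply]; ring)
  obtain ⟨h1, h2⟩ := hG.integral_cond hreg hsample hmodel
    (Q := fun t y => inner ℝ (scoreAt g θ G (t, y)) b ^ 2)
    (((hm.comp (by fun_prop : Measurable fun t : Fin f → ℝ => (t, (1 : ℝ)))).inner
      measurable_const).pow_const 2).aestronglyMeasurable
    (((hm.comp (by fun_prop : Measurable fun t : Fin f → ℝ => (t, (0 : ℝ)))).inner
      measurable_const).pow_const 2).aestronglyMeasurable
    (hgV'.congr (hG.ae_mem.mono fun ω hω => ((key _ hω).1).symm))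
    (hgV.congr (hG.ae_mem.mono fun ω hω => ((key _ hω).2).symm))
  refine ⟨(memLp_two_iff_integrable_sq ?_).2 h1, ?_⟩
  · exact ((hm.comp (hX.prodMk (hsample.measurable_Y_apply j))).inner
      measurable_const).aestronglyMeasurable
  · rw [h2]
    refine integral_congr_ae (hG.ae_mem.mono fun ω hω => ?_)
    simp only [smul_eq_mul]
    rw [(key _ hω).1, (key _ hω).2]
    ring

/-- The mean derivative of the score is `-A`. -/
lemma IsGoodSet.integral_fderiv_score (hG : IsGoodSet μ X g U K G H)
    (hreg : IsRegular μ X Y j g θ U K) (hsample : IsSample μ X Y)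
    (hmodel : μ⟦{ω | Y 0 ω j = 1} | MeasurableSpace.comap (X 0) inferInstance⟧
      =ᵐ[μ] fun ω => g (X 0 ω) θ) (v : EuclideanSpace ℝ (Fin p)) :
    (∫ ω, fderiv ℝ (score g (X 0 ω) (Y 0 ω j)) θ ∂μ) v =
      -∫ ω, (weight g (X 0 ω) θ * inner ℝ (gradAt g θ G (X 0 ω)) v) •
        gradAt g θ G (X 0 ω) ∂μ := by
  have hX := hsample.measurable_X 0
  have hθ := hreg.theta_mem_U
  have hmD := hG.measurable_indicator_fderiv_score hreg.isOpen hreg.measurable hθ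
  have hmy : ∀ y : ℝ, y = 0 ∨ y = 1 →
      Measurable (G.indicator fun t => fderiv ℝ (score g t y) θ) := by
    intro y hy
    convert hmD.comp (by fun_prop : Measurable fun t : Fin f → ℝ => (t, y)) using 1
    ext1 t
    by_cases ht : t ∈ G
    · have : (t, y) ∈ labeledSet G := ⟨ht, hy⟩
      simp [ht, this]
    · have : (t, y) ∉ labeledSet G := fun h => ht h.1
      simp [ht, this]
  have hbd : ∀ (y : ℝ) (q : (Fin f → ℝ) → ℝ), y = 0 ∨ y = 1 → Measurable q →
      (∀ t ∈ G, |q t| ≤ 1) → Integrable (fun ω => q (X 0 ω) •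
        G.indicator (fun t => fderiv ℝ (score g t y) θ) (X 0 ω)) μ := by
    intro y q hy hq hq1
    refine hG.integrable.mono' ((hq.smul (hmy y hy)).comp hX).aestronglyMeasurable ?_
    filter_upwards [hG.ae_mem] with ω hω
    rw [Set.indicator_of_mem hω, norm_smul]
    calc _ ≤ 1 * ‖fderiv ℝ (score g (X 0 ω) y) θ‖ := by gcongr; exact hq1 _ hω
      _ ≤ H (X 0 ω) := by
        rw [one_mul]; exact hG.norm_fderiv_score_le _ hω _ hreg.theta_mem y hy
  have hgm := hreg.measurable_apply
  have hi1 := hbd 1 (fun t => g t θ) (Or.inr rfl) hgm fun t ht => by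
    have h := hG.mem_Ioo _ ht _ hθ
    rw [abs_of_nonneg h.1.le]; exact h.2.le
  have hi0 := hbd 0 (fun t => 1 - g t θ) (Or.inl rfl) (measurable_const.sub hgm) fun t ht => by
    have h := hG.mem_Ioo _ ht _ hθ
    rw [abs_of_nonneg (sub_nonneg.2 h.2.le)]; linarith [h.1]
  obtain ⟨-, h2⟩ := hG.integral_cond hreg hsample hmodel
    (Q := fun t y => G.indicator (fun t => fderiv ℝ (score g t y) θ) t)
    (hmy 1 (Or.inr rfl)).aestronglyMeasurable (hmy 0 (Or.inl rfl)).aestronglyMeasurable hi1 hi0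
  have h3 : ∫ ω, fderiv ℝ (score g (X 0 ω) (Y 0 ω j)) θ ∂μ =
      ∫ ω, G.indicator (fun t => fderiv ℝ (score g t (Y 0 ω j)) θ) (X 0 ω) ∂μ :=
    integral_congr_ae (hG.ae_mem.mono fun ω hω => by simp only [Set.indicator_of_mem hω])
  have hsum : Integrable (fun ω => g (X 0 ω) θ • G.indicator (fun t => fderiv ℝ (score g t 1) θ)
      (X 0 ω) + (1 - g (X 0 ω) θ) • G.indicator (fun t => fderiv ℝ (score g t 0) θ) (X 0 ω)) μ := by
    have h := Integrable.add (ε' := EuclideanSpace ℝ (Fin p) →L[ℝ] EuclideanSpace ℝ (Fin p)) hi1 hi0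
    exact h
  rw [h3, h2, ContinuousLinearMap.integral_apply hsum, ← integral_neg]
  refine integral_congr_ae (hG.ae_mem.mono fun ω hω => ?_)
  simp only [Set.indicator_of_mem hω, gradAt_of_mem hω]
  -- The factor `y - g` averages to `g(1-g) + (1-g)(0-g) = 0`, so the derivative of `w g'` drops
  -- out.
  rw [fderiv_score hreg.isOpen (hG.contDiffOn _ hω) (hG.mem_Ioo _ hω) _ hθ,
    fderiv_score hreg.isOpen (hG.contDiffOn _ hω) (hG.mem_Ioo _ hω) _ hθ, inner_gradient_eq_fderiv]
  simp only [add_apply, smul_apply,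
    sub_apply, ContinuousLinearMap.smulRight_apply]
  module

/-- The variance of the class indicator exceeds that of its conditional probability by the mean
conditional variance. -/
lemma IsGoodSet.variance_Y (hG : IsGoodSet μ X g U K G H)
    (hreg : IsRegular μ X Y j g θ U K) (hsample : IsSample μ X Y)
    (hmodel : μ⟦{ω | Y 0 ω j = 1} | MeasurableSpace.comap (X 0) inferInstance⟧
      =ᵐ[μ] fun ω => g (X 0 ω) θ) :
    Var[fun ω => Y 0 ω j; μ] = Var[fun ω => g (X 0 ω) θ; μ] +
      ∫ ω, g (X 0 ω) θ * (1 - g (X 0 ω) θ) ∂μ := by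
  have hX := hsample.measurable_X 0
  have hY : MemLp (fun ω => Y 0 ω j) 2 μ := by
    refine MemLp.of_bound (hsample.measurable_Y_apply j).aestronglyMeasurable 1
      (ae_of_all _ fun ω => ?_)
    rcases hsample.zero_or_one 0 ω j with h | h <;> simp [h]
  have hg := hG.memLp_apply hreg hX 2
  -- For an indicator `Y² = Y`, so `Var Y = q - q²`, while `Var g = E[g²] - q²` with the same mean
  -- `q`.
  have hYsq : (fun ω => Y 0 ω j) ^ 2 = fun ω => Y 0 ω j := by
    ext ω
    rcases hsample.zero_or_one 0 ω j with h | h <;> simp [h]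
  rw [variance_eq_sub hY, variance_eq_sub hg, hYsq, hG.integral_apply_eq hreg hsample hmodel]
  have h1 : ∫ ω, g (X 0 ω) θ * (1 - g (X 0 ω) θ) ∂μ =
      ∫ ω, g (X 0 ω) θ ∂μ - ∫ ω, ((fun ω => g (X 0 ω) θ) ^ 2) ω ∂μ := by
    simp only [Pi.pow_apply]
    rw [← integral_sub (hG.integrable_apply hreg hX) hg.integrable_sq]
    exact integral_congr_ae (ae_of_all _ fun ω => by ring)
  rw [h1]
  ring

/-- The quadratic form `Bᵀ A⁻¹ B` is at most the mean conditional variance. -/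
lemma IsGoodSet.quadratic_form_le (hG : IsGoodSet μ X g U K G H)
    (hreg : IsRegular μ X Y j g θ U K) (hX : Measurable (X 0)) :
    vecB μ X g θ ⬝ᵥ (matA μ X g θ)⁻¹.mulVec (vecB μ X g θ) ≤
      ∫ ω, g (X 0 ω) θ * (1 - g (X 0 ω) θ) ∂μ := by
  obtain ⟨b, hb1, hb2⟩ := hG.exists_direction hreg hX
  have hi := (hG.integrable_gradAt hreg hX).inner_const (𝕜 := ℝ) b
  have hi2 := hG.integrable_weight_mul_inner_mul_inner hreg hX b b
  have hgg : Integrable (fun ω => g (X 0 ω) θ * (1 - g (X 0 ω) θ)) μ :=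
    ((hG.integrable_apply hreg hX).sub (hG.memLp_apply hreg hX 2).integrable_sq).congr
      (ae_of_all _ fun ω => by simp only [Pi.sub_apply]; ring)
  -- The integrand is `w (⟪g', b⟫ - g(1-g))²`, expanded with `w g (1-g) = 1`. Its mean is `κ - 2κ +
  -- E[g(1-g)]`.
  have h0 : 0 ≤ ∫ ω, (weight g (X 0 ω) θ * inner ℝ (gradAt g θ G (X 0 ω)) b *
      inner ℝ (gradAt g θ G (X 0 ω)) b - 2 * inner ℝ (gradAt g θ G (X 0 ω)) b +
      g (X 0 ω) θ * (1 - g (X 0 ω) θ)) ∂μ := by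
    refine integral_nonneg_of_ae (hG.ae_mem.mono fun ω hω => ?_)
    have hw := hG.weight_mul hω hreg.theta_mem_U
    have hp := hG.weight_pos hω hreg.theta_mem_U
    have h := mul_nonneg hp.le (sq_nonneg (inner ℝ (gradAt g θ G (X 0 ω)) b -
      g (X 0 ω) θ * (1 - g (X 0 ω) θ)))
    simp only [Pi.zero_apply]
    linear_combination h + (-2 * inner ℝ (gradAt g θ G (X 0 ω)) b +
      g (X 0 ω) θ * (1 - g (X 0 ω) θ)) * hw
  have hi3 : Integrable (fun ω => weight g (X 0 ω) θ * inner ℝ (gradAt g θ G (X 0 ω)) b *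
      inner ℝ (gradAt g θ G (X 0 ω)) b - 2 * inner ℝ (gradAt g θ G (X 0 ω)) b) μ :=
    hi2.sub (hi.const_mul 2)
  rw [integral_add hi3 hgg, integral_sub hi2 (hi.const_mul 2),
    integral_const_mul, ← hb1 b] at h0
  rw [hb2]
  linarith

end Conditioning

end Unlabeled

/-! ### Almost sure linearization of the plug-in average -/

namespace Unlabeled

lemma tendstoUniformlyOn_comp {E F : Type*} [UniformSpace F] {Q : ℕ → E → F} {Q₀ : E → F}
    {K : Set E} (h : TendstoUniformlyOn Q Q₀ atTop K) {r : ℕ → ℕ} (hr : Tendsto r atTop atTop) :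
    TendstoUniformlyOn (fun n => Q (r n)) Q₀ atTop K :=
  fun u hu => hr.eventually (h u hu)

section Linearization

variable {Ω : Type*} [MeasurableSpace Ω] {μ : Measure Ω} {f c p : ℕ}
  {X : ℕ → Ω → Fin f → ℝ} {Y : ℕ → Ω → Fin c → ℝ} {j : Fin c}
  {g : (Fin f → ℝ) → EuclideanSpace ℝ (Fin p) → ℝ} {θ : EuclideanSpace ℝ (Fin p)}
  {U K : Set (EuclideanSpace ℝ (Fin p))} {G : Set (Fin f → ℝ)} {H : (Fin f → ℝ) → ℝ}

lemma IsSample.iIndepFun_pair (hsample : IsSample μ X Y) (j : Fin c) :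
    iIndepFun (fun i ω => (X i ω, Y i ω j)) μ :=
  hsample.indep.comp (fun _ (z : (Fin f → ℝ) × (Fin c → ℝ)) => (z.1, z.2 j))
    fun _ => by fun_prop

lemma IsSample.identDistrib_pair (hsample : IsSample μ X Y) (j : Fin c) (i : ℕ) :
    IdentDistrib (fun ω => (X i ω, Y i ω j)) (fun ω => (X 0 ω, Y 0 ω j)) μ μ :=
  (hsample.identDistrib i).comp
    (by fun_prop : Measurable fun z : (Fin f → ℝ) × (Fin c → ℝ) => (z.1, z.2 j))

lemma IsGoodSet.ae_mem_labeledSet (hG : IsGoodSet μ X g U K G H) (hsample : IsSample μ X Y)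
    (j : Fin c) : ∀ᵐ ω ∂μ, (X 0 ω, Y 0 ω j) ∈ labeledSet G :=
  hG.ae_mem.mono fun ω hω => ⟨hω, hsample.zero_or_one 0 ω j⟩

lemma IsGoodSet.ae_all_mem (hG : IsGoodSet μ X g U K G H) (hsample : IsSample μ X Y)
    (j : Fin c) : ∀ᵐ ω ∂μ, ∀ i, (X i ω, Y i ω j) ∈ labeledSet G := by
  rw [ae_all_iff]
  exact fun i => (hsample.identDistrib_pair j i).symm.ae_snd hG.measurableSet_labeledSet
    (hG.ae_mem_labeledSet hsample j)

variable [IsProbabilityMeasure μ]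

/-- Linearization of the plug-in average at roots of the estimating equation. -/
theorem IsGoodSet.eventually_plugin_average_le (hG : IsGoodSet μ X g U K G H)
    (hreg : IsRegular μ X Y j g θ U K) (hsample : IsSample μ X Y)
    (hmodel : μ⟦{ω | Y 0 ω j = 1} | MeasurableSpace.comap (X 0) inferInstance⟧
      =ᵐ[μ] fun ω => g (X 0 ω) θ) {b : EuclideanSpace ℝ (Fin p)}
    (hb : ∀ v, ∫ ω, inner ℝ (gradAt g θ G (X 0 ω)) v ∂μ = ∫ ω, weight g (X 0 ω) θ *
      inner ℝ (gradAt g θ G (X 0 ω)) v * inner ℝ (gradAt g θ G (X 0 ω)) b ∂μ)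
    {r k : ℕ → ℕ} (hr : Tendsto r atTop atTop) (hk : Tendsto k atTop atTop) {ε : ℝ}
    (hε : 0 < ε) :
    ∀ᵐ ω ∂μ, ∀ᶠ n in atTop, ∀ ϑ ∈ K,
      ∑ i ∈ Finset.range (r n), score g (X i ω) (Y i ω j) ϑ = 0 →
      |(1 / (k n : ℝ)) * ∑ i ∈ Finset.range (k n), g (X i ω) ϑ -
        (1 / (k n : ℝ)) * ∑ i ∈ Finset.range (k n), g (X i ω) θ -
        inner ℝ ((r n : ℝ)⁻¹ • ∑ i ∈ Finset.range (r n), scoreAt g θ G (X i ω, Y i ω j)) b| ≤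
      ε * ‖(r n : ℝ)⁻¹ • ∑ i ∈ Finset.range (r n), scoreAt g θ G (X i ω, Y i ω j)‖ := by
  have hX := hsample.measurable_X 0
  have hθ := hreg.theta_mem_U
  have hU := hreg.isOpen
  have hKU := hreg.subset
  have hind := hsample.iIndepFun_pair j
  have hid := hsample.identDistrib_pair j
  have hGT := hG.measurableSet_labeledSet
  have hmem := hG.ae_mem_labeledSet hsample j
  have hHT : Integrable (fun ω => (fun w : (Fin f → ℝ) × ℝ => H w.1) (X 0 ω, Y 0 ω j)) μ :=
    hG.integrable
  have hsc : ∀ w ∈ labeledSet G, ContDiffOn ℝ 1 (score g w.1 w.2) U := fun w hw =>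
    contDiffOn_score hU (hG.contDiffOn w.1 hw.1) (hG.mem_Ioo w.1 hw.1) w.2
  have hgc : ∀ w ∈ labeledSet G, ContDiffOn ℝ 1 (g w.1) U := fun w hw =>
    (hG.contDiffOn w.1 hw.1).of_le (by norm_num)
  obtain ⟨hΨ, hΨc⟩ := uniform_strong_law hind hid hGT hmem hreg.isCompact
    (Q := fun w ϑ => score g w.1 w.2 ϑ) (H := fun w => H w.1)
    (fun ϑ hϑ => hG.measurable_indicator_score hU hreg.measurable (hKU hϑ))
    (fun w hw => (hsc w hw).continuousOn.mono hKU) hHT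
    (fun w hw ϑ hϑ => hG.norm_score_le w.1 hw.1 ϑ hϑ w.2 hw.2)
  obtain ⟨hD, hDc⟩ := uniform_strong_law hind hid hGT hmem hreg.isCompact
    (Q := fun w ϑ => fderiv ℝ (score g w.1 w.2) ϑ) (H := fun w => H w.1)
    (fun ϑ hϑ => hG.measurable_indicator_fderiv_score hU hreg.measurable (hKU hϑ))
    (fun w hw => ((hsc w hw).continuousOn_fderiv_of_isOpen hU le_rfl).mono hKU) hHT
    (fun w hw ϑ hϑ => hG.norm_fderiv_score_le w.1 hw.1 ϑ hϑ w.2 hw.2)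
  obtain ⟨hL, hLc⟩ := uniform_strong_law hind hid hGT hmem hreg.isCompact
    (Q := fun w ϑ => fderiv ℝ (g w.1) ϑ) (H := fun w => H w.1)
    (fun ϑ hϑ => by
      have h := ((hG.measurable_indicator_fderiv hU hreg.measurable (hKU hϑ)).comp
        measurable_fst).indicator hGT
      convert h using 1
      ext1 w
      by_cases hw : w ∈ labeledSet G
      · simp [hw, hw.1]
      · simp [hw])
    (fun w hw => ((hgc w hw).continuousOn_fderiv_of_isOpen hU le_rfl).mono hKU) hHT
    (fun w hw ϑ hϑ => by
      rw [norm_fderiv_eq_norm_gradient]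
      exact hG.norm_gradient_le w.1 hw.1 ϑ hϑ)
  have hD₀ := hG.integral_fderiv_score hreg hsample hmodel
  -- An injective linear map on a finite-dimensional space is bounded below.
  obtain ⟨C, hC, hinv⟩ : ∃ C > 0, ∀ v, ‖v‖ ≤
      C * ‖(∫ ω, fderiv ℝ (score g (X 0 ω) (Y 0 ω j)) θ ∂μ) v‖ := by
    obtain ⟨C, hC, hanti⟩ := LinearMap.exists_antilipschitzWith
      (∫ ω, fderiv ℝ (score g (X 0 ω) (Y 0 ω j)) θ ∂μ).toLinearMap (by
        rw [LinearMap.ker_eq_bot']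
        intro v hv
        have hv' : (∫ ω, fderiv ℝ (score g (X 0 ω) (Y 0 ω j)) θ ∂μ) v = 0 := hv
        rw [hD₀, neg_eq_zero] at hv'
        exact hG.eq_zero_of_integral_eq_zero hreg hX hv')
    exact ⟨C, hC, fun v => ContinuousLinearMap.bound_of_antilipschitz
      (∫ ω, fderiv ℝ (score g (X 0 ω) (Y 0 ω j)) θ ∂μ) hanti v⟩
  -- With `Λ = ⟪b, ·⟫` this is `⟪B, v⟫ = ⟪b, A v⟫`, the mean derivative of the score being `-A`.
  have hΛ : ∀ v, (∫ ω, fderiv ℝ (g (X 0 ω)) θ ∂μ) v =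
      -innerSL ℝ b ((∫ ω, fderiv ℝ (score g (X 0 ω) (Y 0 ω j)) θ ∂μ) v) := by
    intro v
    have hLi : Integrable (fun ω => fderiv ℝ (g (X 0 ω)) θ) μ := by
      refine hG.integrable.mono' (((hG.measurable_indicator_fderiv hU hreg.measurable hθ).comp
        hX).aestronglyMeasurable.congr (hG.ae_mem.mono fun ω hω => ?_))
        (hG.ae_mem.mono fun ω hω => ?_)
      · exact Set.indicator_of_mem hω _
      · rw [norm_fderiv_eq_norm_gradient]
        exact hG.norm_gradient_le _ hω _ hreg.theta_mem
    rw [hD₀, map_neg, neg_neg, ContinuousLinearMap.integral_apply hLi, innerSL_apply_apply,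
      ← integral_inner (hG.integrable_weight_mul_inner_smul hreg hX v)]
    calc _ = ∫ ω, inner ℝ (gradAt g θ G (X 0 ω)) v ∂μ :=
          integral_congr_ae (hG.ae_mem.mono fun ω hω => by
            simp only [gradAt_of_mem hω]
            rw [inner_gradient_eq_fderiv])
      _ = _ := by
          rw [hb v]
          refine integral_congr_ae (ae_of_all _ fun ω => ?_)
          simp only [real_inner_smul_right, real_inner_comm b]
  filter_upwards [hΨ, hD, hL, hG.ae_all_mem hsample j] with ω h1 h2 h3 hall
  -- The path is now fixed. The score is averaged over `r n` terms and `g` over `k n` terms, so the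
  -- limits are taken along both subsequences.
  have key := eventually_plugin_linearization (l := atTop) hreg.isCompact hreg.mem_interior
    (tendstoUniformlyOn_comp h1 hr) hΨc hreg.identifiable
    (D := fun n ϑ => (r n : ℝ)⁻¹ • ∑ i ∈ Finset.range (r n),
      fderiv ℝ (score g (X i ω) (Y i ω j)) ϑ)
    (Eventually.of_forall fun n ϑ hϑ => by
      have h : HasFDerivAt (fun ϑ => ∑ i ∈ Finset.range (r n), score g (X i ω) (Y i ω j) ϑ)
          (∑ i ∈ Finset.range (r n), fderiv ℝ (score g (X i ω) (Y i ω j)) ϑ) ϑ :=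
        HasFDerivAt.fun_sum fun i _ =>
          (((hsc _ (hall i)).contDiffAt (hU.mem_nhds (hKU hϑ))).differentiableAt
            (by norm_num)).hasFDerivAt
      exact h.const_smul (r n : ℝ)⁻¹)
    (tendstoUniformlyOn_comp h2 hr) hDc
    (Γ := fun n ϑ => (k n : ℝ)⁻¹ • ∑ i ∈ Finset.range (k n), g (X i ω) ϑ)
    (L := fun n ϑ => (k n : ℝ)⁻¹ • ∑ i ∈ Finset.range (k n), fderiv ℝ (g (X i ω)) ϑ)
    (Eventually.of_forall fun n ϑ hϑ => by
      have h : HasFDerivAt (fun ϑ => ∑ i ∈ Finset.range (k n), g (X i ω) ϑ)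
          (∑ i ∈ Finset.range (k n), fderiv ℝ (g (X i ω)) ϑ) ϑ := HasFDerivAt.fun_sum fun i _ =>
        (((hgc _ (hall i)).contDiffAt (hU.mem_nhds (hKU hϑ))).differentiableAt
          (by norm_num)).hasFDerivAt
      exact h.const_smul (k n : ℝ)⁻¹)
    (tendstoUniformlyOn_comp h3 hk) hLc hC hinv hΛ hε
  filter_upwards [key] with n hn ϑ hϑ hroot
  have h := hn ϑ hϑ (by simp only [hroot, smul_zero])
  have hsum : ∀ m, ∑ i ∈ Finset.range m, scoreAt g θ G (X i ω, Y i ω j) =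
      ∑ i ∈ Finset.range m, score g (X i ω) (Y i ω j) θ := fun m =>
    Finset.sum_congr rfl fun i _ => scoreAt_of_mem (hall i).1 _
  simp only [smul_eq_mul, innerSL_apply_apply] at h
  simpa only [hsum, one_div, real_inner_comm b] using h

end Linearization

end Unlabeled

/-! ### Negligible remainder, variance and uniqueness of the limit -/

namespace Unlabeled

section Estimators

variable {Ω : Type*} [MeasurableSpace Ω] {μ : Measure Ω} {f c p : ℕ}
  {X : ℕ → Ω → Fin f → ℝ} {Y : ℕ → Ω → Fin c → ℝ} {j : Fin c}
  {g : (Fin f → ℝ) → EuclideanSpace ℝ (Fin p) → ℝ} {θ : EuclideanSpace ℝ (Fin p)}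
  {U K : Set (EuclideanSpace ℝ (Fin p))} {G : Set (Fin f → ℝ)} {H : (Fin f → ℝ) → ℝ}
  {θhat : ℕ → Ω → EuclideanSpace ℝ (Fin p)}

lemma aemeasurable_qHat (hsample : IsSample μ X Y) (hg : Measurable (Function.uncurry g))
    (hθ : ∀ m, AEMeasurable (θhat m) μ) (m n : ℕ) : AEMeasurable (qHat X g θhat m n) μ :=
  (Finset.aemeasurable_fun_sum _ fun i _ =>
    hg.comp_aemeasurable ((hsample.measurable_X i).aemeasurable.prodMk (hθ m))).const_mul _

lemma tendsto_atTop_of_ratio {r : ℕ → ℕ} {γ : ℝ} (hγ : 0 < γ)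
    (hrγ : Tendsto (fun n : ℕ => (r n : ℝ) / (n : ℝ)) atTop (𝓝 γ)) : Tendsto r atTop atTop := by
  rw [← tendsto_natCast_atTop_iff (R := ℝ)]
  refine (hrγ.pos_mul_atTop hγ tendsto_natCast_atTop_atTop).congr' ?_
  filter_upwards [eventually_ne_atTop 0] with n hn
  have hn' : (n : ℝ) ≠ 0 := by exact_mod_cast hn
  field_simp

variable [IsProbabilityMeasure μ]

lemma IsGoodSet.integral_inner_score (hG : IsGoodSet μ X g U K G H)
    (hreg : IsRegular μ X Y j g θ U K) (hsample : IsSample μ X Y)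
    (hmodel : μ⟦{ω | Y 0 ω j = 1} | MeasurableSpace.comap (X 0) inferInstance⟧
      =ᵐ[μ] fun ω => g (X 0 ω) θ) (b : EuclideanSpace ℝ (Fin p)) :
    ∫ ω, inner ℝ (scoreAt g θ G (X 0 ω, Y 0 ω j)) b ∂μ = 0 := by
  simpa using hG.integral_mul_inner_score hreg hsample hmodel (h := fun _ => 1)
    measurable_const (C := 1) (fun _ _ => by simp) b

/-- Coordinatewise these are sums of independent centred terms, and `V` is the sum of the coordinate
variances. This makes `√n` times the averaged score bounded in mean square. -/
lemma IsGoodSet.exists_integral_norm_sum_score_sq (hG : IsGoodSet μ X g U K G H)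
    (hreg : IsRegular μ X Y j g θ U K) (hsample : IsSample μ X Y)
    (hmodel : μ⟦{ω | Y 0 ω j = 1} | MeasurableSpace.comap (X 0) inferInstance⟧
      =ᵐ[μ] fun ω => g (X 0 ω) θ) :
    ∃ V : ℝ, ∀ m : ℕ,
      Integrable (fun ω => ‖∑ i ∈ Finset.range m, scoreAt g θ G (X i ω, Y i ω j)‖ ^ 2) μ ∧
      ∫ ω, ‖∑ i ∈ Finset.range m, scoreAt g θ G (X i ω, Y i ω j)‖ ^ 2 ∂μ = m * V := by
  have hm := hG.measurable_scoreAt hreg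
  have hu : ∀ l : Fin p, Measurable fun w : (Fin f → ℝ) × ℝ =>
      inner ℝ (scoreAt g θ G w) (EuclideanSpace.single l 1) := fun l => hm.inner measurable_const
  have hexp : ∀ (m : ℕ) ω, ‖∑ i ∈ Finset.range m, scoreAt g θ G (X i ω, Y i ω j)‖ ^ 2 =
      ∑ l : Fin p, (∑ i ∈ Finset.range m, inner ℝ (scoreAt g θ G (X i ω, Y i ω j))
        (EuclideanSpace.single l 1)) ^ 2 := by
    intro m ω
    rw [EuclideanSpace.norm_sq_eq]
    refine Finset.sum_congr rfl fun l _ => ?_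
    rw [← sum_inner]
    simp [EuclideanSpace.inner_single_right]
  have hint : ∀ (m : ℕ) (l : Fin p), Integrable (fun ω => (∑ i ∈ Finset.range m,
      inner ℝ (scoreAt g θ G (X i ω, Y i ω j)) (EuclideanSpace.single l 1)) ^ 2) μ := fun m l =>
    (memLp_sum_range (hsample.identDistrib_pair j) (hu l)
      (hG.memLp_inner_score hreg hsample hmodel _).1 m).integrable_sq
  refine ⟨∑ l : Fin p, Var[fun ω => inner ℝ (scoreAt g θ G (X 0 ω, Y 0 ω j))
    (EuclideanSpace.single l 1); μ], fun m => ?_⟩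
  simp_rw [hexp m]
  refine ⟨integrable_finsetSum _ fun l _ => hint m l, ?_⟩
  rw [integral_finsetSum _ fun l _ => hint m l, Finset.mul_sum]
  exact Finset.sum_congr rfl fun l _ => integral_sq_sum_range (hsample.iIndepFun_pair j)
    (hsample.identDistrib_pair j) (hu l) (hG.memLp_inner_score hreg hsample hmodel _).1
    (hG.integral_inner_score hreg hsample hmodel _) m

/-- The plug-in average differs from its linearization by `o_P(n^{-1/2})`. -/
theorem IsGoodSet.tendstoInMeasure_remainder (hG : IsGoodSet μ X g U K G H)
    (hreg : IsRegular μ X Y j g θ U K) (hsample : IsSample μ X Y)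
    (hmodel : μ⟦{ω | Y 0 ω j = 1} | MeasurableSpace.comap (X 0) inferInstance⟧
      =ᵐ[μ] fun ω => g (X 0 ω) θ) (hroot : IsRootEstimator μ X Y j g K θhat)
    {b : EuclideanSpace ℝ (Fin p)}
    (hb : ∀ v, ∫ ω, inner ℝ (gradAt g θ G (X 0 ω)) v ∂μ = ∫ ω, weight g (X 0 ω) θ *
      inner ℝ (gradAt g θ G (X 0 ω)) v * inner ℝ (gradAt g θ G (X 0 ω)) b ∂μ)
    {r k : ℕ → ℕ} (hk : Tendsto k atTop atTop) {γ : ℝ} (hγ : 0 < γ)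
    (hrγ : Tendsto (fun n : ℕ => (r n : ℝ) / (n : ℝ)) atTop (𝓝 γ)) :
    TendstoInMeasure μ (fun (n : ℕ) ω => √(n : ℝ) * (qHat X g θhat (r n) (k n) ω -
      (1 / (k n : ℝ)) * ∑ i ∈ Finset.range (k n), g (X i ω) θ -
      (1 / (r n : ℝ)) * ∑ i ∈ Finset.range (r n),
        inner ℝ (scoreAt g θ G (X i ω, Y i ω j)) b)) atTop 0 := by
  have hr := tendsto_atTop_of_ratio hγ hrγ
  have hm := hG.measurable_scoreAt hreg
  have hWm : ∀ i, Measurable fun ω => (X i ω, Y i ω j) := fun i =>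
    (hsample.measurable_X i).prodMk ((measurable_pi_apply j).comp (hsample.measurable_Y i))
  obtain ⟨V, hV⟩ := hG.exists_integral_norm_sum_score_sq hreg hsample hmodel
  have hratio : Tendsto (fun n : ℕ => (n : ℝ) / r n * V) atTop (𝓝 (γ⁻¹ * V)) :=
    ((hrγ.inv₀ hγ.ne').congr fun n => inv_div _ _).mul_const V
  obtain ⟨C, hC⟩ := hratio.bddAbove_range
  have hsq : ∀ (n : ℕ) ω, (√(n : ℝ) *
      ‖(r n : ℝ)⁻¹ • ∑ i ∈ Finset.range (r n), scoreAt g θ G (X i ω, Y i ω j)‖) ^ 2 =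
      (n : ℝ) * (r n : ℝ)⁻¹ ^ 2 *
        ‖∑ i ∈ Finset.range (r n), scoreAt g θ G (X i ω, Y i ω j)‖ ^ 2 := by
    intro n ω
    rw [norm_smul, mul_pow, mul_pow, Real.sq_sqrt (Nat.cast_nonneg n), Real.norm_eq_abs, sq_abs]
    ring
  have hgm : ∀ i, Measurable fun ω => g (X i ω) θ := fun i =>
    hreg.measurable_apply.comp (hsample.measurable_X i)
  have hsm : ∀ i, Measurable fun ω => scoreAt g θ G (X i ω, Y i ω j) := fun i => hm.comp (hWm i)
  have hgs : ∀ m : ℕ, Measurable fun ω => (1 / (m : ℝ)) * ∑ i ∈ Finset.range m, g (X i ω) θ :=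
    fun m => (Finset.measurable_fun_sum _ fun i _ => hgm i).const_mul _
  have hbs : ∀ m : ℕ, Measurable fun ω => (1 / (m : ℝ)) * ∑ i ∈ Finset.range m,
      inner ℝ (scoreAt g θ G (X i ω, Y i ω j)) b := fun m =>
    (Finset.measurable_fun_sum _ fun i _ => (hsm i).inner measurable_const).const_mul _
  have hss : ∀ m : ℕ, Measurable fun ω => (m : ℝ)⁻¹ • ∑ i ∈ Finset.range m,
      scoreAt g θ G (X i ω, Y i ω j) := by
    intro m
    have h : Measurable fun ω => ∑ i ∈ Finset.range m, scoreAt g θ G (X i ω, Y i ω j) :=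
      Finset.measurable_fun_sum _ fun i _ => hsm i
    exact h.const_smul (m : ℝ)⁻¹
  refine tendstoInMeasure_mul_of_eventually_le (S := fun n ω =>
    ‖(r n : ℝ)⁻¹ • ∑ i ∈ Finset.range (r n), scoreAt g θ G (X i ω, Y i ω j)‖) (C := C)
    (B := fun n => {ω | θhat (r n) ω ∈ K ∧
      ∑ i ∈ Finset.range (r n), score g (X i ω) (Y i ω j) (θhat (r n) ω) = 0})
    (fun n => ?_) (fun n => ?_) (fun n ω => norm_nonneg _) (hroot.2.comp hr) (fun ε hε => ?_)
    (fun n => Real.sqrt_nonneg _) (fun n => ?_) (fun n => ?_)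
  · exact ((aemeasurable_qHat hsample hreg.measurable hroot.1 _ _).sub
      (hgs (k n)).aemeasurable).sub (hbs (r n)).aemeasurable
  · exact (hss (r n)).norm.aemeasurable
  · filter_upwards [hG.eventually_plugin_average_le hreg hsample hmodel hb hr hk hε] with ω hω
    filter_upwards [hω] with n hn hB
    have h := hn (θhat (r n) ω) hB.1 hB.2
    rw [real_inner_smul_left, sum_inner] at h
    rw [one_div (r n : ℝ)]
    exact h
  · simp_rw [hsq n]
    exact (hV (r n)).1.const_mul _
  · simp_rw [hsq n]
    rw [integral_const_mul, (hV (r n)).2]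
    refine le_trans (le_of_eq ?_) (hC ⟨n, rfl⟩)
    -- With no labeled observation both sides vanish, by the convention for division by zero.
    rcases eq_or_ne (r n) 0 with h0 | h0
    · simp [h0]
    · have : (r n : ℝ) ≠ 0 := by exact_mod_cast h0
      field_simp

/-- Variance of a linear combination of the conditional probability and the linearized score. -/
lemma IsGoodSet.variance_linear_combination (hG : IsGoodSet μ X g U K G H)
    (hreg : IsRegular μ X Y j g θ U K) (hsample : IsSample μ X Y)
    (hmodel : μ⟦{ω | Y 0 ω j = 1} | MeasurableSpace.comap (X 0) inferInstance⟧
      =ᵐ[μ] fun ω => g (X 0 ω) θ) (b : EuclideanSpace ℝ (Fin p)) (α β : ℝ) :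
    Var[fun ω => α * (g (X 0 ω) θ - ∫ ω, g (X 0 ω) θ ∂μ) +
      β * inner ℝ (scoreAt g θ G (X 0 ω, Y 0 ω j)) b; μ] =
    α ^ 2 * Var[fun ω => g (X 0 ω) θ; μ] + β ^ 2 * ∫ ω, weight g (X 0 ω) θ *
      inner ℝ (gradAt g θ G (X 0 ω)) b * inner ℝ (gradAt g θ G (X 0 ω)) b ∂μ := by
  have hX := hsample.measurable_X 0
  set q := ∫ ω, g (X 0 ω) θ ∂μ with hq
  have hg2 : MemLp (fun ω => g (X 0 ω) θ - q) 2 μ :=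
    (hG.memLp_apply hreg hX 2).sub (memLp_const q)
  obtain ⟨hb2, hbV⟩ := hG.memLp_inner_score hreg hsample hmodel b
  have hg0 : ∫ ω, (g (X 0 ω) θ - q) ∂μ = 0 := by
    rw [integral_sub (hG.integrable_apply hreg hX) (integrable_const _)]
    simp [hq]
  have hb0 := hG.integral_inner_score hreg hsample hmodel b
  have hgb : ∫ ω, (g (X 0 ω) θ - q) * inner ℝ (scoreAt g θ G (X 0 ω, Y 0 ω j)) b ∂μ = 0 := by
    refine hG.integral_mul_inner_score hreg hsample hmodel (h := fun t => g t θ - q)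
      (hreg.measurable_apply.sub_const q) (C := 1 + |q|) (fun t ht => ?_) b
    have h := hG.mem_Ioo t ht θ hreg.theta_mem_U
    refine (abs_sub _ _).trans (add_le_add ?_ le_rfl)
    rw [abs_of_nonneg h.1.le]
    exact h.2.le
  -- The score is centred given the feature, hence uncorrelated with any bounded function of it.
  have hcov : cov[fun ω => g (X 0 ω) θ - q,
      fun ω => inner ℝ (scoreAt g θ G (X 0 ω, Y 0 ω j)) b; μ] = 0 := by
    rw [covariance_eq_sub hg2 hb2, hg0, zero_mul, sub_zero]
    exact hgb
  have hvb : Var[fun ω => inner ℝ (scoreAt g θ G (X 0 ω, Y 0 ω j)) b; μ] = _ :=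
    (variance_of_integral_eq_zero hb2.aestronglyMeasurable.aemeasurable hb0).trans hbV
  rw [variance_fun_add (hg2.const_mul α) (hb2.const_mul β), variance_const_mul,
    variance_const_mul, covariance_const_mul_left, covariance_const_mul_right, hcov, hvb,
    variance_sub_const (hG.memLp_apply hreg hX 2).aestronglyMeasurable]
  ring

end Estimators

/-- A limit law is unique and a Gaussian law determines its variance; the condition `0 ≤ s` makes
`Real.toNNReal` lose nothing. -/
lemma HasLimitVariance.unique {Ω : Type*} [MeasurableSpace Ω] {μ : Measure Ω}
    [IsProbabilityMeasure μ] {S : ℕ → Ω → ℝ} {q s s' : ℝ} (h : HasLimitVariance μ S q s)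
    (h' : HasLimitVariance μ S q s') : s = s' := by
  have he := tendstoInDistribution_unique _ h.2 h'.2
  rw [Measure.map_id, Measure.map_id] at he
  have := (gaussianReal_ext_iff.1 he).2
  rwa [Real.toNNReal_eq_toNNReal_iff h.1 h'.1] at this

end Unlabeled

/-! ### Limit laws of the three estimators -/

namespace Unlabeled

section Estimators

variable {Ω : Type*} [MeasurableSpace Ω] {μ : Measure Ω} [IsProbabilityMeasure μ] {f c p : ℕ}
  {X : ℕ → Ω → Fin f → ℝ} {Y : ℕ → Ω → Fin c → ℝ} {j : Fin c}
  {g : (Fin f → ℝ) → EuclideanSpace ℝ (Fin p) → ℝ} {θ : EuclideanSpace ℝ (Fin p)}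
  {U K : Set (EuclideanSpace ℝ (Fin p))} {G : Set (Fin f → ℝ)} {H : (Fin f → ℝ) → ℝ}
  {θhat : ℕ → Ω → EuclideanSpace ℝ (Fin p)} {r : ℕ → ℕ} {γ : ℝ}

/-- Limit law of the estimator that uses all features. -/
theorem IsGoodSet.hasLimitVariance_qHat (hG : IsGoodSet μ X g U K G H)
    (hreg : IsRegular μ X Y j g θ U K) (hsample : IsSample μ X Y)
    (hmodel : μ⟦{ω | Y 0 ω j = 1} | MeasurableSpace.comap (X 0) inferInstance⟧
      =ᵐ[μ] fun ω => g (X 0 ω) θ) (hroot : IsRootEstimator μ X Y j g K θhat)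
    (hr : ∀ n, r n ≤ n) (hγ : 0 < γ)
    (hrγ : Tendsto (fun n : ℕ => (r n : ℝ) / (n : ℝ)) atTop (𝓝 γ)) :
    HasLimitVariance μ (fun n => qHat X g θhat (r n) n) (∫ ω, Y 0 ω j ∂μ)
      (Var[fun ω => g (X 0 ω) θ; μ] +
        γ⁻¹ * (vecB μ X g θ ⬝ᵥ (matA μ X g θ)⁻¹.mulVec (vecB μ X g θ))) := by
  have hX := hsample.measurable_X 0
  obtain ⟨b, hb, hκ⟩ := hG.exists_direction hreg hX
  have hrem := hG.tendstoInMeasure_remainder hreg hsample hmodel hroot hb tendsto_id hγ hrγ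
  rw [hG.integral_apply_eq hreg hsample hmodel]
  have hbm : Measurable fun w : (Fin f → ℝ) × ℝ => inner ℝ (scoreAt g θ G w) b :=
    (hG.measurable_scoreAt hreg).inner measurable_const
  have hvar := hG.variance_linear_combination hreg hsample hmodel b
  set q := ∫ ω, g (X 0 ω) θ ∂μ with hq
  have ham : Measurable fun w : (Fin f → ℝ) × ℝ => g w.1 θ - q :=
    (hreg.measurable_apply.comp measurable_fst).sub_const q
  have ha2 : MemLp (fun ω => g (X 0 ω) θ - q) 2 μ :=
    (hG.memLp_apply hreg hX 2).sub (memLp_const q)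
  have ha0 : ∫ ω, (g (X 0 ω) θ - q) ∂μ = 0 := by
    rw [integral_sub (hG.integrable_apply hreg hX) (integrable_const _)]
    simp [hq]
  refine hasLimitVariance_of_two_blocks (hsample.iIndepFun_pair j) (hsample.identDistrib_pair j)
    ham hbm ham ha2 (hG.memLp_inner_score hreg hsample hmodel b).1 ha2 ha0
    (hG.integral_inner_score hreg hsample hmodel b) ha0 hr hγ hrγ
    (fun n => aemeasurable_qHat hsample hreg.measurable hroot.1 _ _)
    (hrem.congr_left fun n => ae_of_all _ fun ω => ?_) ?_
  · rcases Nat.eq_zero_or_pos n with hn | hn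
    · simp [hn]
    · have hn' : (n : ℝ) ≠ 0 := by exact_mod_cast hn.ne'
      have hsum : ∑ i ∈ Finset.range (r n), (g (X i ω) θ - q) +
          ∑ i ∈ Finset.Ico (r n) n, (g (X i ω) θ - q) =
          ∑ i ∈ Finset.range n, g (X i ω) θ - n * q := by
        rw [Finset.sum_range_add_sum_Ico _ (hr n), Finset.sum_sub_distrib]
        simp
      simp only [id_eq]
      rw [Finset.sum_add_distrib, ← Finset.mul_sum, add_right_comm, hsum]
      congr 1
      field_simp
      ring
  -- The labeled block has variance `V + γ⁻² κ`, the unlabeled one `V`; weighting by `γ` and `1 - γ`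
  -- gives `V + γ⁻¹ κ`.
  · have h1 := hvar 1 γ⁻¹
    have h2 := hvar 1 0
    simp only [one_mul, one_pow, zero_mul, add_zero, ne_eq, OfNat.ofNat_ne_zero,
      not_false_eq_true, zero_pow] at h1 h2
    rw [h1, h2, ← hb b, hκ]
    field_simp
    ring

/-- Limit law of the estimator that uses the labeled observations only. -/
theorem IsGoodSet.hasLimitVariance_qHat_labeled (hG : IsGoodSet μ X g U K G H)
    (hreg : IsRegular μ X Y j g θ U K) (hsample : IsSample μ X Y)
    (hmodel : μ⟦{ω | Y 0 ω j = 1} | MeasurableSpace.comap (X 0) inferInstance⟧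
      =ᵐ[μ] fun ω => g (X 0 ω) θ) (hroot : IsRootEstimator μ X Y j g K θhat)
    (hr : ∀ n, r n ≤ n) (hγ : 0 < γ)
    (hrγ : Tendsto (fun n : ℕ => (r n : ℝ) / (n : ℝ)) atTop (𝓝 γ)) :
    HasLimitVariance μ (fun n => qHat X g θhat (r n) (r n)) (∫ ω, Y 0 ω j ∂μ)
      (γ⁻¹ * (Var[fun ω => g (X 0 ω) θ; μ] +
        vecB μ X g θ ⬝ᵥ (matA μ X g θ)⁻¹.mulVec (vecB μ X g θ))) := by
  have hX := hsample.measurable_X 0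
  have hrt := tendsto_atTop_of_ratio hγ hrγ
  obtain ⟨b, hb, hκ⟩ := hG.exists_direction hreg hX
  have hrem := hG.tendstoInMeasure_remainder hreg hsample hmodel hroot hb hrt hγ hrγ
  rw [hG.integral_apply_eq hreg hsample hmodel]
  have hbm : Measurable fun w : (Fin f → ℝ) × ℝ => inner ℝ (scoreAt g θ G w) b :=
    (hG.measurable_scoreAt hreg).inner measurable_const
  have hvar := hG.variance_linear_combination hreg hsample hmodel b
  set q := ∫ ω, g (X 0 ω) θ ∂μ with hq
  have ham : Measurable fun w : (Fin f → ℝ) × ℝ => g w.1 θ - q :=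
    (hreg.measurable_apply.comp measurable_fst).sub_const q
  have ha2 : MemLp (fun ω => g (X 0 ω) θ - q) 2 μ :=
    (hG.memLp_apply hreg hX 2).sub (memLp_const q)
  have ha0 : ∫ ω, (g (X 0 ω) θ - q) ∂μ = 0 := by
    rw [integral_sub (hG.integrable_apply hreg hX) (integrable_const _)]
    simp [hq]
  have hb2 := (hG.memLp_inner_score hreg hsample hmodel b).1
  have hb0 := hG.integral_inner_score hreg hsample hmodel b
  -- Averages over `r n` terms carry the factor `n / r n` relative to `1/n`, so everything goes into
  -- `y`, and the unlabeled block is zero.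
  refine hasLimitVariance_of_two_blocks (hsample.iIndepFun_pair j) (hsample.identDistrib_pair j)
    (x := fun _ => 0) (y := fun w => (g w.1 θ - q) + inner ℝ (scoreAt g θ G w) b)
    (z := fun _ => 0) measurable_const (ham.add hbm) measurable_const (memLp_const 0)
    (ha2.add hb2) (memLp_const 0) (by simp) ?_ (by simp) hr hγ hrγ
    (fun n => aemeasurable_qHat hsample hreg.measurable hroot.1 _ _)
    (hrem.congr' ?_ EventuallyEq.rfl) ?_
  · rw [integral_add (ha2.integrable (by norm_num)) (hb2.integrable (by norm_num)), ha0, hb0,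
      add_zero]
  · filter_upwards [hrt.eventually_ne_atTop 0, eventually_ne_atTop 0] with n hrn hn
    have hn' : (n : ℝ) ≠ 0 := by exact_mod_cast hn
    have hrn' : (r n : ℝ) ≠ 0 := by exact_mod_cast hrn
    refine ae_of_all _ fun ω => ?_
    simp only [zero_add, Finset.sum_const_zero, add_zero, ← Finset.mul_sum,
      Finset.sum_add_distrib, Finset.sum_sub_distrib, Finset.sum_const, Finset.card_range,
      nsmul_eq_mul]
    congr 1
    field_simp
    ring
  · have h0 : Var[fun _ : Ω => (0 : ℝ); μ] = 0 := variance_zero μ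
    have h1 := hvar γ⁻¹ γ⁻¹
    simp only [zero_add, mul_add]
    rw [h1, ← hb b, hκ, h0]
    field_simp
    ring

/-- Limit law of the class proportion among the labeled observations. -/
theorem IsSample.hasLimitVariance_yBar (hsample : IsSample μ X Y) (j : Fin c)
    (hr : ∀ n, r n ≤ n) (hγ : 0 < γ)
    (hrγ : Tendsto (fun n : ℕ => (r n : ℝ) / (n : ℝ)) atTop (𝓝 γ)) :
    HasLimitVariance μ (fun n => yBar Y j (r n)) (∫ ω, Y 0 ω j ∂μ)
      (γ⁻¹ * Var[fun ω => Y 0 ω j; μ]) := by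
  have hrt := tendsto_atTop_of_ratio hγ hrγ
  have hYm : ∀ i, Measurable fun ω => Y i ω j := fun i =>
    (measurable_pi_apply j).comp (hsample.measurable_Y i)
  set q := ∫ ω, Y 0 ω j ∂μ with hq
  have hY : MemLp (fun ω => Y 0 ω j) 2 μ := by
    refine MemLp.of_bound (hYm 0).aestronglyMeasurable 1 (ae_of_all _ fun ω => ?_)
    rcases hsample.zero_or_one 0 ω j with h | h <;> simp [h]
  have hy2 : MemLp (fun ω => Y 0 ω j - q) 2 μ := hY.sub (memLp_const q)
  refine hasLimitVariance_of_two_blocks (hsample.iIndepFun_pair j) (hsample.identDistrib_pair j)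
    (x := fun _ => 0) (y := fun w => w.2 - q) (z := fun _ => 0) measurable_const
    (measurable_snd.sub_const q) measurable_const (memLp_const 0) hy2 (memLp_const 0) (by simp)
    ?_ (by simp) hr hγ hrγ (fun n => ((Finset.measurable_fun_sum _ fun i _ =>
      hYm i).const_mul _).aemeasurable) ?_ ?_
  · rw [integral_sub (hY.integrable (by norm_num)) (integrable_const _)]
    simp [hq]
  -- The sample proportion is already linear: its remainder is exactly zero once `n` and `r n` are
  -- nonzero.
  · refine TendstoInMeasure.congr' (f := fun _ => 0) (g := 0) ?_ EventuallyEq.rfl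
      (tendstoInMeasure_of_tendsto_ae (fun _ => aestronglyMeasurable_zero)
        (ae_of_all _ fun _ => tendsto_const_nhds))
    filter_upwards [hrt.eventually_ne_atTop 0, eventually_ne_atTop 0] with n hrn hn
    have hn' : (n : ℝ) ≠ 0 := by exact_mod_cast hn
    have hrn' : (r n : ℝ) ≠ 0 := by exact_mod_cast hrn
    refine ae_of_all _ fun ω => ?_
    simp only [zero_add, Finset.sum_const_zero, add_zero, ← Finset.mul_sum,
      Finset.sum_sub_distrib, Finset.sum_const, Finset.card_range, nsmul_eq_mul,
      Pi.zero_apply]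
    field_simp
    ring
  · have h0 : Var[fun _ : Ω => (0 : ℝ); μ] = 0 := variance_zero μ
    simp only [zero_add]
    rw [variance_const_mul, variance_sub_const (hYm 0).aestronglyMeasurable, h0]
    field_simp
    ring

end Estimators

end Unlabeled

/-! ### The main theorem -/

theorem mainTheorem3 {Ω : Type*} [MeasurableSpace Ω] (μ : Measure Ω) [IsProbabilityMeasure μ]
    {f c p : ℕ} (X : ℕ → Ω → Fin f → ℝ) (Y : ℕ → Ω → Fin c → ℝ)
    (hsample : Unlabeled.IsSample μ X Y) (j : Fin c)
    (g : (Fin f → ℝ) → EuclideanSpace ℝ (Fin p) → ℝ) (θ : EuclideanSpace ℝ (Fin p))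
    (hmodel : μ⟦{ω | Y 0 ω j = 1} | MeasurableSpace.comap (X 0) inferInstance⟧
      =ᵐ[μ] fun ω => g (X 0 ω) θ)
    (U K : Set (EuclideanSpace ℝ (Fin p)))
    (hreg : Unlabeled.IsRegular μ X Y j g θ U K)
    (θhat : ℕ → Ω → EuclideanSpace ℝ (Fin p))
    (hroot : Unlabeled.IsRootEstimator μ X Y j g K θhat)
    (r : ℕ → ℕ) (hr : ∀ n, r n ≤ n) (γ : ℝ) (hγ : 0 < γ)
    (hrγ : Tendsto (fun n : ℕ => (r n : ℝ) / (n : ℝ)) atTop (𝓝 γ)) :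
    -- asymptotic variances: labeled and unlabeled data, labeled data only, sample proportion
    Unlabeled.HasAsymptoticVariance μ (fun n => Unlabeled.qHat X g θhat (r n) n)
      (∫ ω, Y 0 ω j ∂μ) (fun n => Unlabeled.avarQHat μ X g θ (r n) n) ∧
    Unlabeled.HasAsymptoticVariance μ (fun n => Unlabeled.qHat X g θhat (r n) (r n))
      (∫ ω, Y 0 ω j ∂μ) (fun n => Unlabeled.avarQHat μ X g θ (r n) (r n)) ∧
    Unlabeled.HasAsymptoticVariance μ (fun n => Unlabeled.yBar Y j (r n))
      (∫ ω, Y 0 ω j ∂μ) (fun n => Unlabeled.avarYBar μ Y j (r n)) ∧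
    -- comparison for `m` labeled observations out of `n`
    (∀ m n : ℕ, 1 ≤ m → m ≤ n →
      Unlabeled.avarQHat μ X g θ m m - Unlabeled.avarQHat μ X g θ m n =
        (1 / (m : ℝ) - 1 / (n : ℝ)) * variance (fun ω => g (X 0 ω) θ) μ ∧
      Unlabeled.avarQHat μ X g θ m m ≤ Unlabeled.avarYBar μ Y j m ∧
      Unlabeled.avarQHat μ X g θ m n ≤ Unlabeled.avarYBar μ Y j m ∧
      ((¬ ∃ a : ℝ, ∀ᵐ ω ∂μ, g (X 0 ω) θ = a) → m < n →
        Unlabeled.avarQHat μ X g θ m n < Unlabeled.avarYBar μ Y j m)) ∧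
    -- comparison of the variances of the limiting normal distributions
    (∀ s₁ s₂ : ℝ,
      Unlabeled.HasLimitVariance μ (fun n => Unlabeled.qHat X g θhat (r n) n)
        (∫ ω, Y 0 ω j ∂μ) s₁ →
      Unlabeled.HasLimitVariance μ (fun n => Unlabeled.yBar Y j (r n))
        (∫ ω, Y 0 ω j ∂μ) s₂ →
      s₁ ≤ s₂ ∧
      ((¬ ∃ a : ℝ, ∀ᵐ ω ∂μ, g (X 0 ω) θ = a) → γ < 1 → s₁ < s₂)) := by
  have hX := hsample.measurable_X 0
  obtain ⟨G, H, hG⟩ := hreg.exists_isGoodSet hX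
  have hγ1 : γ ≤ 1 := le_of_tendsto hrγ <| Eventually.of_forall fun n =>
    div_le_one_of_le₀ (by exact_mod_cast hr n) (Nat.cast_nonneg n)
  have h1 := hG.hasLimitVariance_qHat hreg hsample hmodel hroot hr hγ hrγ
  have h2 := hG.hasLimitVariance_qHat_labeled hreg hsample hmodel hroot hr hγ hrγ
  have h3 := hsample.hasLimitVariance_yBar j hr hγ hrγ
  have hvY := hG.variance_Y hreg hsample hmodel
  have hκ := hG.quadratic_form_le hreg hX
  have hVpos : (¬ ∃ a : ℝ, ∀ᵐ ω ∂μ, g (X 0 ω) θ = a) → 0 < variance (fun ω => g (X 0 ω) θ) μ := by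
    intro hne
    refine lt_of_le_of_ne (variance_nonneg _ _) fun h0 => hne ⟨∫ ω, g (X 0 ω) θ ∂μ, ?_⟩
    exact ae_eq_integral_of_variance_eq_zero (hG.memLp_apply hreg hX 2) h0.symm
  have hV0 : 0 ≤ variance (fun ω => g (X 0 ω) θ) μ := variance_nonneg _ _
  set V := variance (fun ω => g (X 0 ω) θ) μ
  set κ := Unlabeled.vecB μ X g θ ⬝ᵥ
    (Unlabeled.matA μ X g θ)⁻¹.mulVec (Unlabeled.vecB μ X g θ)
  -- Both comparisons come from this inequality; strictness comes only from the extra term in `V`.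
  have hle : V + κ ≤ variance (fun ω => Y 0 ω j) μ := by linarith
  have hinv : Tendsto (fun n : ℕ => (n : ℝ) / r n) atTop (𝓝 γ⁻¹) :=
    (hrγ.inv₀ hγ.ne').congr fun n => inv_div _ _
  refine ⟨⟨_, ?_, h1⟩, ⟨_, ?_, h2⟩, ⟨_, ?_, h3⟩, fun m n hm hmn => ?_, fun s₁ s₂ hs₁ hs₂ => ?_⟩
  · refine ((hinv.mul_const κ).const_add V).congr' ?_
    filter_upwards [eventually_ne_atTop 0] with n hn
    have hn' : (n : ℝ) ≠ 0 := by exact_mod_cast hn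
    change _ = (n : ℝ) * (1 / (n : ℝ) * V + 1 / (r n : ℝ) * κ)
    rw [mul_add, ← mul_assoc, mul_one_div_cancel hn', one_mul]
    ring
  · refine (hinv.mul_const (V + κ)).congr fun n => ?_
    change _ = (n : ℝ) * (1 / (r n : ℝ) * V + 1 / (r n : ℝ) * κ)
    ring
  · refine (hinv.mul_const _).congr fun n => ?_
    change _ = (n : ℝ) * (1 / (r n : ℝ) * variance (fun ω => Y 0 ω j) μ)
    ring
  · have hm0 : (0 : ℝ) < m := by exact_mod_cast hm
    have hmn' : (m : ℝ) ≤ n := by exact_mod_cast hmn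
    have e1 : Unlabeled.avarQHat μ X g θ m m - Unlabeled.avarQHat μ X g θ m n =
        (1 / (m : ℝ) - 1 / (n : ℝ)) * V := by
      change (1 / (m : ℝ) * V + 1 / (m : ℝ) * κ) - (1 / (n : ℝ) * V + 1 / (m : ℝ) * κ) = _
      ring
    have e2 : Unlabeled.avarQHat μ X g θ m m ≤ Unlabeled.avarYBar μ Y j m := by
      change 1 / (m : ℝ) * V + 1 / (m : ℝ) * κ ≤ 1 / (m : ℝ) * _
      rw [← mul_add]
      gcongr
    have e3 : 1 / (n : ℝ) ≤ 1 / (m : ℝ) := one_div_le_one_div_of_le hm0 hmn'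
    have e4 := mul_nonneg (sub_nonneg.2 e3) hV0
    refine ⟨e1, e2, by linarith, fun hne hlt => ?_⟩
    have hlt' : (m : ℝ) < n := by exact_mod_cast hlt
    have e5 := mul_pos (sub_pos.2 (one_div_lt_one_div_of_lt hm0 hlt')) (hVpos hne)
    linarith
  -- Here `V + κ/γ = (V + κ)/γ - (γ⁻¹ - 1) V`, and the subtracted term is positive when `γ < 1` and
  -- `V > 0`.
  · rw [hs₁.unique h1, hs₂.unique h3]
    have hγi : 1 ≤ γ⁻¹ := (one_le_inv₀ hγ).2 hγ1
    have e1 : γ⁻¹ * (V + κ) ≤ γ⁻¹ * variance (fun ω => Y 0 ω j) μ := by gcongr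
    have e2 := mul_nonneg (sub_nonneg.2 hγi) hV0
    refine ⟨by linarith, fun hne hlt => ?_⟩
    have e3 := mul_pos (sub_pos.2 ((one_lt_inv₀ hγ).2 hlt)) (hVpos hne)
    linarith
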